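/- For $m\in\mathbb{Z}$ let $J_m$ be the Bessel function of the first kind of order $m$. Let $z_{m1}<z_{m2}<\cdots$ be the nonnegative zeros of $J_m'$ in increasing order, where $x=0$ is counted as a zero if and only if $m=0$ (so $z_{01}=0$, and for $m\neq0$ all $z_{mn}$ are positive). Let $a>0$ and let $\mathbb{B}_a^2$ be the closed disk of radius $a$ about the origin of $\mathbb{R}^2$. For $n\ge 1$ put $\rho_{nm}:=z_{mn}/a$, $$N_n^{(m)}(a):=\frac{a^2}{2}\Big(1-\frac{m^2}{z_{mn}^2}\Big)J_m(z_{mn})^2\quad\text{if }z_{mn}\ne0,\qquad N_1^{(0)}(a):=\frac{a^2}{2},$$ $$\Psi_{nm}^a(r,\theta):=\frac{1}{\sqrt{N_n^{(m)}(a)}}\,J_m(\rho_{nm}r)\,\frac{e^{\mathrm{i}m\theta}}{\sqrt{2\pi}},\qquad C_{n,m}^a(\xi):=\int_0^a\int_0^{2\pi}\xi(r,\theta)\,\overline{\Psi_{nm}^a(r,\theta)}\,r\,d\theta\,dr .$$ For $\mathbf{k}=(k_1,k_2)\in\mathbb{Z}^2$ let $|\mathbf{k}|$ be its Euclidean length,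 $\Phi(\mathbf{k})\in[0,2\pi)$ its polar angle (with $\Phi(0)=0$), and $$\widehat{\xi}\{\mathbf{k}\}:=\int_0^a\int_0^{2\pi}\xi(r,\theta)\,e^{-\pi\mathrm{i}a^{-1}r(k_1\cos\theta+k_2\sin\theta)}\,r\,d\theta\,dr .$$ **Theorem.** Let $a>0$, $\xi\in L^2(\mathbb{B}_a^2)$, $m\in\mathbb{Z}$ and $n\in\mathbb{N}$, $n\ge1$. Then $$C_{n,m}^a(\xi)=\sum_{\mathbf{k}\in\mathbb{Z}^2}c_a'(\mathbf{k};n,m)\,\widehat{\xi}\{\mathbf{k}\}$$ (an unconditionally convergent sum), where $$c_a'(\mathbf{k};n,m):=\pi\sqrt{\pi}\;\frac{\mathrm{i}^{|m|}(-1)^{n-1}\,|\mathbf{k}|\,\rho_{nm}\,J_m'(\pi|\mathbf{k}|)\,e^{-\mathrm{i}m\Phi(\mathbf{k})}}{2\,(z_{mn}^2-m^2)^{1/2}\,(z_{mn}^2-\pi^2|\mathbf{k}|^2)} .$$ Here expressions $0/0$ stand for their limits: for $m=0$, $n=1$ the factor $\rho_{nm}/(z_{mn}^2-m^2)^{1/2}$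 means $1/a$; and if $\pi|\mathbf{k}|=z_{mn}$, the factor $\pi|\mathbf{k}|J_m'(\pi|\mathbf{k}|)/(z_{mn}^2-\pi^2|\mathbf{k}|^2)$ means the limit of $tJ_m'(t)/(z_{mn}^2-t^2)$ as $t\to z_{mn}$, which is $-\tfrac12J_m''(z_{mn})$ if $z_{mn}>0$ and $\tfrac12$ if $z_{mn}=0$. -/

import Mathlib

open MeasureTheory

noncomputable section

/-- The Bessel function of the first kind `J_m` of integer order `m`, by Bessel's integral
`J_m(x) = (1/π) ∫_0^π cos (m τ - x sin τ) dτ`. -/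
def besselJ (m : ℤ) (x : ℝ) : ℝ :=
  (1 / Real.pi) * ∫ τ in (0 : ℝ)..Real.pi, Real.cos ((m : ℝ) * τ - x * Real.sin τ)

/-- The derivative `J_m'`. -/
def besselJ' (m : ℤ) (x : ℝ) : ℝ := deriv (besselJ m) x

/-- The second derivative `J_m''`. -/
def besselJ'' (m : ℤ) (x : ℝ) : ℝ := deriv (besselJ' m) x

/-- The nonnegative zeros of `J_m'` admitted by the derivative boundary condition: all positive
zeros, and the zero `0` exactly when `m = 0` (for `|m| ≥ 2` one also has `J_m'(0) = 0`, but
`J_m(0 · r)` is then the zero function, which is not an eigenfunction). -/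
def neumannZeroSet (m : ℤ) : Set ℝ :=
  {x : ℝ | 0 ≤ x ∧ besselJ' m x = 0 ∧ (x = 0 → m = 0)}

/-- `neumannZero m n` is `z_{mn}`, the `n`-th smallest element of `neumannZeroSet m`, for `n ≥ 1`
(so `z_{01} = 0`). The value at `n = 0` is a placeholder which is never used. -/
def neumannZero (m : ℤ) : ℕ → ℝ
  | 0 => 0
  | 1 => sInf (neumannZeroSet m)
  | n + 2 => sInf {x : ℝ | x ∈ neumannZeroSet m ∧ neumannZero m (n + 1) < x}

/-- The normalization constant `N_n^{(m)}(a) = (a² / 2) (1 - m² / z_{mn}²) J_m(z_{mn})²`,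
with `N_1^{(0)}(a) = a² / 2`. -/
def neumannNorm (a : ℝ) (n : ℕ) (m : ℤ) : ℝ :=
  if neumannZero m n = 0 then a ^ 2 / 2
  else a ^ 2 / 2 * (1 - (m : ℝ) ^ 2 / neumannZero m n ^ 2) * besselJ m (neumannZero m n) ^ 2

/-- The basis function `Ψ_{nm}^a(r, θ) = N_n^{(m)}(a)^{-1/2} J_m(z_{mn} r / a) e^{imθ} / √(2π)`. -/
def neumannBasis (a : ℝ) (n : ℕ) (m : ℤ) (r θ : ℝ) : ℂ :=
  ((1 / Real.sqrt (neumannNorm a n m) * besselJ m (neumannZero m n / a * r) : ℝ) : ℂ) *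
    ((1 / Real.sqrt (2 * Real.pi) : ℝ) * Complex.exp (Complex.I * (m : ℂ) * (θ : ℂ)))

/-- The closed Euclidean disk of radius `a` about the origin of `ℝ²`. -/
def planarDisk (a : ℝ) : Set (ℝ × ℝ) := {p : ℝ × ℝ | p.1 ^ 2 + p.2 ^ 2 ≤ a ^ 2}

/-- `C_{n,m}^a(ξ) = ∫_0^a ∫_0^{2π} ξ(r, θ) conj Ψ_{nm}^a(r, θ) r dθ dr`. -/
def neumannCoeff (a : ℝ) (n : ℕ) (m : ℤ) (ξ : ℝ × ℝ → ℂ) : ℂ :=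
  ∫ r in (0 : ℝ)..a, ∫ θ in (0 : ℝ)..(2 * Real.pi),
    ξ (r * Real.cos θ, r * Real.sin θ) * (starRingEnd ℂ) (neumannBasis a n m r θ) * (r : ℂ)

/-- The Fourier coefficient
`∫_0^a ∫_0^{2π} ξ(r, θ) e^{-π i r (k₁ cos θ + k₂ sin θ) / a} r dθ dr`. -/
def diskFourier (a : ℝ) (ξ : ℝ × ℝ → ℂ) (k : ℤ × ℤ) : ℂ :=
  ∫ r in (0 : ℝ)..a, ∫ θ in (0 : ℝ)..(2 * Real.pi),
    ξ (r * Real.cos θ, r * Real.sin θ) *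
      Complex.exp (-(Complex.I *
        ((Real.pi * a⁻¹ * r * (k.1 * Real.cos θ + k.2 * Real.sin θ) : ℝ) : ℂ))) * (r : ℂ)

/-- The Euclidean length `|k|`. -/
def latticeNorm (k : ℤ × ℤ) : ℝ := Real.sqrt ((k.1 : ℝ) ^ 2 + (k.2 : ℝ) ^ 2)

/-- The polar angle `Φ(k) ∈ [0, 2π)` of `k` (equal to `0` at `k = 0`). -/
def latticeAngle (k : ℤ × ℤ) : ℝ :=
  if 0 ≤ Complex.arg ((k.1 : ℂ) + (k.2 : ℂ) * Complex.I) then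
    Complex.arg ((k.1 : ℂ) + (k.2 : ℂ) * Complex.I)
  else Complex.arg ((k.1 : ℂ) + (k.2 : ℂ) * Complex.I) + 2 * Real.pi

/-- The factor `ρ_{nm} / (z_{mn}² - m²)^{1/2}`, with `ρ_{nm} = z_{mn} / a`. If `z_{mn} = 0`
(that is, `m = 0` and `n = 1`), it has the value `1 / a = lim_{z → 0+} (z / a) / (z²)^{1/2}`. -/
def neumannAmplitude (a : ℝ) (n : ℕ) (m : ℤ) : ℝ :=
  if neumannZero m n = 0 then 1 / a
  else (neumannZero m n / a) / Real.sqrt (neumannZero m n ^ 2 - (m : ℝ) ^ 2)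

/-- The factor `t J_m'(t) / (z² - t²)` for `z, t ≥ 0`, where `z` is one of the numbers `z_{mn}`.
At `t = z` the singularity is removable and the factor has its limit as its value:
`-J_m''(z) / 2` for `z > 0`, and `-J_0''(0) = 1 / 2` for `z = 0` (which forces `m = 0`). -/
def neumannQuotient (m : ℤ) (z t : ℝ) : ℝ :=
  if t ≠ z then t * besselJ' m t / (z ^ 2 - t ^ 2)
  else if z = 0 then 1 / 2
  else -besselJ'' m z / 2

/-- The weight
`c_a'(k; n, m) = π √π i^{|m|} (-1)^{n-1} |k| ρ_{nm} J_m'(π|k|) e^{-imΦ(k)}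
  / (2 (z_{mn}² - m²)^{1/2} (z_{mn}² - π²|k|²))`,
with removable singularities filled in by their limits. Since `n ≥ 1`, the sign `(-1)^{n-1}` is
written `(-1)^{n+1}`. -/
def neumannWeight (a : ℝ) (n : ℕ) (m : ℤ) (k : ℤ × ℤ) : ℂ :=
  (Real.sqrt Real.pi : ℂ) / 2 * Complex.I ^ m.natAbs * (-1) ^ (n + 1) *
    Complex.exp (-(Complex.I * (m : ℂ) * (latticeAngle k : ℂ))) *
    ((neumannAmplitude a n m *
      neumannQuotient m (neumannZero m n) (Real.pi * latticeNorm k) : ℝ) : ℂ)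

end

/-! Extend the conjugate of `Ψ` and `ξ` by zero from the disk to the square of side `2a`. There the
characters `exp(πi k·p/a)` form an orthogonal basis with squared norm `4a²`, so Parseval
(`hasSum_setIntegral_planarDisk_mul`) writes the integral of `ξ` against the conjugate of `Ψ` as a
sum over `k`. One factor of each term is the Fourier coefficient of `ξ`; the other, divided by
`4a²`, has to be the weight.

That factor is computed in polar coordinates. The angular integral is Bessel's integral and gives
`2π i^m e^{-imΦ} J_m(π|k|r/a)` (`integral_exp_mul_exp_cos`). The radial integral of a product of two
Bessel functions is Lommel's (`integral_besselJ_mul_besselJ_of_mem`); as `J_m'` vanishes at `z =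
z_{mn}`, it equals `J_m(z)` times the removable quotient, up to the factor `a²`.

Normalizing by `√N` leaves only the sign of `J_m(z_{mn})`. This is where `(-1)^{n-1}` comes from:
for `m ≥ 0` the value at the first zero is positive and the signs then alternate, while `J_{-m} =
(-1)^m J_m` turns `i^m` into `i^{|m|}`. The sign argument, and the fact that the infima defining
`z_{mn}` are attained, rest on a qualitative study of Bessel's equation: the critical points are
unbounded, isolated on the right, and the positive ones lie beyond `|m|`. -/

/-! ### Derivatives, differential equation and recurrence from Bessel's integral. -/

theorem hasDerivAt_integral_mul_cos_phase (m : ℤ) (w : ℝ → ℝ) (hw : Continuous w) (x : ℝ) :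
    HasDerivAt (fun x : ℝ => ∫ τ in (0 : ℝ)..Real.pi, w τ * Real.cos (m * τ - x * Real.sin τ))
      (∫ τ in (0 : ℝ)..Real.pi, w τ * (Real.sin τ * Real.sin (m * τ - x * Real.sin τ))) x := by
  refine (intervalIntegral.hasDerivAt_integral_of_dominated_loc_of_deriv_le
    (F' := fun x τ => w τ * (Real.sin τ * Real.sin (m * τ - x * Real.sin τ)))
    (bound := fun τ => |w τ|) (s := Set.univ) Filter.univ_mem ?_ ?_ ?_ ?_ ?_ ?_).2
  · exact Filter.Eventually.of_forall fun y => (by fun_prop : Continuous _).aestronglyMeasurable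
  · exact (by fun_prop : Continuous _).intervalIntegrable _ _
  · exact (by fun_prop : Continuous _).aestronglyMeasurable
  · refine Filter.Eventually.of_forall fun τ _ y _ => ?_
    rw [norm_mul, norm_mul, Real.norm_eq_abs, Real.norm_eq_abs, Real.norm_eq_abs]
    exact mul_le_of_le_one_right (abs_nonneg _)
      (mul_le_one₀ (Real.abs_sin_le_one _) (abs_nonneg _) (Real.abs_sin_le_one _))
  · exact (by fun_prop : Continuous _).intervalIntegrable _ _
  · refine Filter.Eventually.of_forall fun τ _ y _ => ?_
    have h : HasDerivAt (fun y : ℝ => (m : ℝ) * τ - y * Real.sin τ) (-(1 * Real.sin τ)) y :=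
      ((hasDerivAt_id y).mul_const (Real.sin τ)).const_sub _
    convert! (h.cos).const_mul (w τ) using 1
    ring

theorem hasDerivAt_integral_mul_sin_phase (m : ℤ) (w : ℝ → ℝ) (hw : Continuous w) (x : ℝ) :
    HasDerivAt (fun x : ℝ => ∫ τ in (0 : ℝ)..Real.pi, w τ * Real.sin (m * τ - x * Real.sin τ))
      (∫ τ in (0 : ℝ)..Real.pi, w τ * (-Real.sin τ * Real.cos (m * τ - x * Real.sin τ))) x := by
  refine (intervalIntegral.hasDerivAt_integral_of_dominated_loc_of_deriv_le
    (F' := fun x τ => w τ * (-Real.sin τ * Real.cos (m * τ - x * Real.sin τ)))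
    (bound := fun τ => |w τ|) (s := Set.univ) Filter.univ_mem ?_ ?_ ?_ ?_ ?_ ?_).2
  · exact Filter.Eventually.of_forall fun y => (by fun_prop : Continuous _).aestronglyMeasurable
  · exact (by fun_prop : Continuous _).intervalIntegrable _ _
  · exact (by fun_prop : Continuous _).aestronglyMeasurable
  · refine Filter.Eventually.of_forall fun τ _ y _ => ?_
    rw [norm_mul, norm_mul, norm_neg, Real.norm_eq_abs, Real.norm_eq_abs, Real.norm_eq_abs]
    exact mul_le_of_le_one_right (abs_nonneg _)
      (mul_le_one₀ (Real.abs_sin_le_one _) (abs_nonneg _) (Real.abs_cos_le_one _))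
  · exact (by fun_prop : Continuous _).intervalIntegrable _ _
  · refine Filter.Eventually.of_forall fun τ _ y _ => ?_
    have h : HasDerivAt (fun y : ℝ => (m : ℝ) * τ - y * Real.sin τ) (-(1 * Real.sin τ)) y :=
      ((hasDerivAt_id y).mul_const (Real.sin τ)).const_sub _
    convert! (h.sin).const_mul (w τ) using 1
    ring

theorem hasDerivAt_besselJ_integral (m : ℤ) (x : ℝ) :
    HasDerivAt (besselJ m) ((1 / Real.pi) * ∫ τ in (0 : ℝ)..Real.pi,
      Real.sin τ * Real.sin (m * τ - x * Real.sin τ)) x := by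
  have h := (hasDerivAt_integral_mul_cos_phase m (fun _ => 1) continuous_const x).const_mul
    (1 / Real.pi)
  simp only [one_mul] at h
  exact h

theorem besselJ'_eq_integral (m : ℤ) (x : ℝ) :
    besselJ' m x = (1 / Real.pi) * ∫ τ in (0 : ℝ)..Real.pi,
      Real.sin τ * Real.sin (m * τ - x * Real.sin τ) :=
  (hasDerivAt_besselJ_integral m x).deriv

theorem hasDerivAt_besselJ (m : ℤ) (x : ℝ) : HasDerivAt (besselJ m) (besselJ' m x) x :=
  (hasDerivAt_besselJ_integral m x).differentiableAt.hasDerivAt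

theorem hasDerivAt_besselJ'_integral (m : ℤ) (x : ℝ) :
    HasDerivAt (besselJ' m) ((1 / Real.pi) * ∫ τ in (0 : ℝ)..Real.pi,
      Real.sin τ * (-Real.sin τ * Real.cos (m * τ - x * Real.sin τ))) x := by
  have h := (hasDerivAt_integral_mul_sin_phase m Real.sin Real.continuous_sin x).const_mul
    (1 / Real.pi)
  exact h.congr_of_eventuallyEq (Filter.Eventually.of_forall fun y => besselJ'_eq_integral m y)

theorem besselJ''_eq_integral (m : ℤ) (x : ℝ) :
    besselJ'' m x = (1 / Real.pi) * ∫ τ in (0 : ℝ)..Real.pi,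
      Real.sin τ * (-Real.sin τ * Real.cos (m * τ - x * Real.sin τ)) :=
  (hasDerivAt_besselJ'_integral m x).deriv

theorem hasDerivAt_besselJ' (m : ℤ) (x : ℝ) : HasDerivAt (besselJ' m) (besselJ'' m x) x :=
  (hasDerivAt_besselJ'_integral m x).differentiableAt.hasDerivAt

@[fun_prop]
theorem continuous_besselJ (m : ℤ) : Continuous (besselJ m) :=
  continuous_iff_continuousAt.2 fun x => (hasDerivAt_besselJ m x).continuousAt

@[fun_prop]
theorem continuous_besselJ' (m : ℤ) : Continuous (besselJ' m) :=
  continuous_iff_continuousAt.2 fun x => (hasDerivAt_besselJ' m x).continuousAt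

/-- Bessel's differential equation. -/
theorem besselJ_ode (m : ℤ) (x : ℝ) :
    x ^ 2 * besselJ'' m x + x * besselJ' m x + (x ^ 2 - m ^ 2) * besselJ m x = 0 := by
  have key : (∫ τ in (0 : ℝ)..Real.pi,
      (x ^ 2 * (Real.sin τ * (-Real.sin τ * Real.cos (m * τ - x * Real.sin τ))) +
        x * (Real.sin τ * Real.sin (m * τ - x * Real.sin τ)) +
        (x ^ 2 - m ^ 2) * Real.cos (m * τ - x * Real.sin τ))) = 0 := by
    -- The integrand is an exact derivative, and its primitive vanishes at both ends because `sin
    -- (mπ) = 0`.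
    rw [intervalIntegral.integral_eq_sub_of_hasDerivAt
      (f := fun τ => -((m + x * Real.cos τ) * Real.sin (m * τ - x * Real.sin τ)))]
    · simp
    · intro τ _
      have h1 : HasDerivAt (fun τ : ℝ => (m : ℝ) * τ - x * Real.sin τ)
          (m * 1 - x * Real.cos τ) τ :=
        ((hasDerivAt_id τ).const_mul _).sub ((Real.hasDerivAt_sin τ).const_mul x)
      have h2 : HasDerivAt (fun τ : ℝ => (m : ℝ) + x * Real.cos τ) (x * -Real.sin τ) τ :=
        ((Real.hasDerivAt_cos τ).const_mul x).const_add _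
      convert! (h2.mul h1.sin).neg using 1
      linear_combination (-x ^ 2 * Real.cos (m * τ - x * Real.sin τ)) * Real.sin_sq_add_cos_sq τ
    · exact (by fun_prop : Continuous _).intervalIntegrable _ _
  rw [intervalIntegral.integral_add, intervalIntegral.integral_add,
    intervalIntegral.integral_const_mul, intervalIntegral.integral_const_mul,
    intervalIntegral.integral_const_mul] at key
  · rw [besselJ''_eq_integral, besselJ'_eq_integral, besselJ]
    linear_combination (1 / Real.pi) * key
  all_goals exact (by fun_prop : Continuous _).intervalIntegrable _ _

theorem besselJ_succ_recurrence (m : ℤ) (x : ℝ) :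
    x * besselJ' (m + 1) x + (m + 1) * besselJ (m + 1) x = x * besselJ m x := by
  have key : (∫ τ in (0 : ℝ)..Real.pi,
      (x * (Real.sin τ * Real.sin (((m + 1 : ℤ) : ℝ) * τ - x * Real.sin τ)) +
        (m + 1) * Real.cos (((m + 1 : ℤ) : ℝ) * τ - x * Real.sin τ) -
        x * Real.cos (m * τ - x * Real.sin τ))) = 0 := by
    rw [intervalIntegral.integral_eq_sub_of_hasDerivAt
      (f := fun τ => Real.sin (((m + 1 : ℤ) : ℝ) * τ - x * Real.sin τ))]
    · simp [-Int.cast_add]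
    · intro τ _
      have h1 : HasDerivAt (fun τ : ℝ => ((m + 1 : ℤ) : ℝ) * τ - x * Real.sin τ)
          (((m + 1 : ℤ) : ℝ) * 1 - x * Real.cos τ) τ :=
        ((hasDerivAt_id τ).const_mul _).sub ((Real.hasDerivAt_sin τ).const_mul x)
      convert! h1.sin using 1
      have h2 : (m : ℝ) * τ - x * Real.sin τ =
          (((m + 1 : ℤ) : ℝ) * τ - x * Real.sin τ) - τ := by push_cast; ring
      rw [h2, Real.cos_sub (((m + 1 : ℤ) : ℝ) * τ - x * Real.sin τ) τ]
      push_cast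
      ring
    · exact (by fun_prop : Continuous _).intervalIntegrable _ _
  rw [intervalIntegral.integral_sub, intervalIntegral.integral_add,
    intervalIntegral.integral_const_mul, intervalIntegral.integral_const_mul,
    intervalIntegral.integral_const_mul] at key
  · rw [besselJ'_eq_integral, besselJ, besselJ]
    linear_combination (1 / Real.pi) * key
  all_goals exact (by fun_prop : Continuous _).intervalIntegrable _ _

/-- Substitute `τ ↦ π - τ` in Bessel's integral. -/
theorem besselJ_neg_order (m : ℤ) (x : ℝ) : besselJ (-m) x = (-1) ^ m * besselJ m x := by
  have h := intervalIntegral.integral_comp_sub_left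
    (fun τ => Real.cos (((-m : ℤ) : ℝ) * τ - x * Real.sin τ)) Real.pi (a := 0) (b := Real.pi)
  rw [sub_self, sub_zero] at h
  have h2 : ∀ τ : ℝ, Real.cos (((-m : ℤ) : ℝ) * (Real.pi - τ) - x * Real.sin (Real.pi - τ)) =
      (-1) ^ m * Real.cos (m * τ - x * Real.sin τ) := fun τ => by
    rw [← Real.cos_sub_int_mul_pi, Real.sin_pi_sub]
    congr 1
    push_cast
    ring
  simp only [h2, intervalIntegral.integral_const_mul] at h
  rw [besselJ, ← h, besselJ]
  ring

theorem besselJ_zero_zero : besselJ 0 0 = 1 := by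
  simp [besselJ, Real.pi_ne_zero]

theorem besselJ_zero_right {m : ℤ} (hm : m ≠ 0) : besselJ m 0 = 0 := by
  have h := besselJ_ode m 0
  have hm' : (m : ℝ) ≠ 0 := by exact_mod_cast hm
  simpa [hm'] using h

theorem abs_besselJ_le_one (m : ℤ) (x : ℝ) : |besselJ m x| ≤ 1 := by
  have h : ‖∫ τ in (0 : ℝ)..Real.pi, Real.cos (m * τ - x * Real.sin τ)‖ ≤ 1 * |Real.pi - 0| :=
    intervalIntegral.norm_integral_le_of_norm_le_const fun τ _ => Real.abs_cos_le_one _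
  rw [sub_zero, abs_of_pos Real.pi_pos, one_mul, Real.norm_eq_abs] at h
  rw [besselJ, abs_mul, abs_of_pos (one_div_pos.2 Real.pi_pos), one_div_mul_eq_div,
    div_le_one Real.pi_pos]
  exact h

/-! ### Behaviour near the origin and the energy identity. -/

/-- Start from `J_0(0) = 1` and climb in the order with `(y^{k+1} J_{k+1})' = y^{k+1} J_k`; the same
`ε` survives every step. -/
theorem exists_besselJ_natCast_pos :
    ∃ ε > 0, ∀ m : ℕ, ∀ x ∈ Set.Ioo (0 : ℝ) ε, 0 < besselJ m x := by
  have h0 : ∀ᶠ x in nhds (0 : ℝ), 0 < besselJ 0 x :=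
    (continuous_besselJ 0).continuousAt.eventually (lt_mem_nhds (by simp [besselJ_zero_zero]))
  obtain ⟨ε, hε, h⟩ := Metric.eventually_nhds_iff_ball.1 h0
  refine ⟨ε, hε, fun m => ?_⟩
  induction m with
  | zero =>
    intro x hx
    exact h x (by simpa [Real.dist_eq, abs_of_pos hx.1] using hx.2)
  | succ k ih =>
    intro x hx
    have hd : ∀ y : ℝ, HasDerivAt (fun y => y ^ (k + 1) * besselJ (k + 1 : ℤ) y)
        (y ^ (k + 1) * besselJ k y) y := fun y => by
      convert! (hasDerivAt_pow (k + 1) y).mul (hasDerivAt_besselJ (k + 1 : ℤ) y) using 1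
      have := besselJ_succ_recurrence k y
      push_cast at this ⊢
      linear_combination (-y ^ k) * this
    have hm : StrictMonoOn (fun y => y ^ (k + 1) * besselJ (k + 1 : ℤ) y) (Set.Icc 0 x) := by
      refine strictMonoOn_of_deriv_pos (convex_Icc _ _)
        (fun y _ => (hd y).continuousAt.continuousWithinAt) fun y hy => ?_
      rw [interior_Icc] at hy
      rw [(hd y).deriv]
      exact mul_pos (pow_pos hy.1 _) (ih y ⟨hy.1, hy.2.trans hx.2⟩)
    have := hm (Set.left_mem_Icc.2 hx.1.le) (Set.right_mem_Icc.2 hx.1.le) hx.1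
    simp only [zero_pow (Nat.succ_ne_zero k), zero_mul] at this
    push_cast
    exact pos_of_mul_pos_right this (pow_nonneg hx.1.le _)

theorem exists_besselJ_ne_zero (m : ℤ) : ∃ ε > 0, ∀ x ∈ Set.Ioo (0 : ℝ) ε, besselJ m x ≠ 0 := by
  obtain ⟨ε, hε, h⟩ := exists_besselJ_natCast_pos
  refine ⟨ε, hε, fun x hx => ?_⟩
  obtain ⟨k, rfl | rfl⟩ := m.eq_nat_or_neg
  · exact (h k x hx).ne'
  · rw [besselJ_neg_order]
    exact mul_ne_zero (zpow_ne_zero _ (by norm_num)) (h k x hx).ne'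

theorem hasDerivAt_mul_besselJ' (m : ℤ) {x : ℝ} (hx : x ≠ 0) :
    HasDerivAt (fun x => x * besselJ' m x) ((m ^ 2 - x ^ 2) / x * besselJ m x) x := by
  convert! (hasDerivAt_id x).mul (hasDerivAt_besselJ' m x) using 1
  simp only [id]
  field_simp
  linear_combination (-1 : ℝ) * besselJ_ode m x

/-- Bessel's equation multiplied by `2 J_m'`. Integrated, it locates the critical points and also
supplies the norm integral on the diagonal `t = z`. -/
theorem hasDerivAt_besselJ_energy (m : ℤ) (x : ℝ) :
    HasDerivAt (fun x => (x * besselJ' m x) ^ 2 + (x ^ 2 - m ^ 2) * besselJ m x ^ 2)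
      (2 * x * besselJ m x ^ 2) x := by
  convert! (((hasDerivAt_id x).mul (hasDerivAt_besselJ' m x)).pow 2).add
    (((hasDerivAt_pow 2 x).sub_const ((m : ℝ) ^ 2)).mul ((hasDerivAt_besselJ m x).pow 2)) using 1
  simp only [id, Pi.mul_apply, Pi.pow_apply]
  push_cast
  linear_combination (-2 * besselJ' m x) * besselJ_ode m x

theorem sq_int_mul_besselJ_zero_sq (m : ℤ) : (m : ℝ) ^ 2 * besselJ m 0 ^ 2 = 0 := by
  rcases eq_or_ne m 0 with rfl | hm
  · simp
  · simp [besselJ_zero_right hm]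

theorem two_mul_integral_besselJ_sq (m : ℤ) (z : ℝ) :
    ∫ x in (0 : ℝ)..z, 2 * x * besselJ m x ^ 2 =
      (z * besselJ' m z) ^ 2 + (z ^ 2 - m ^ 2) * besselJ m z ^ 2 := by
  rw [intervalIntegral.integral_eq_sub_of_hasDerivAt
    (fun x _ => hasDerivAt_besselJ_energy m x)
    ((by fun_prop : Continuous _).intervalIntegrable _ _)]
  linear_combination (1 : ℝ) * sq_int_mul_besselJ_zero_sq m

theorem besselJ_energy_pos (m : ℤ) {z : ℝ} (hz : 0 < z) :
    0 < (z * besselJ' m z) ^ 2 + (z ^ 2 - m ^ 2) * besselJ m z ^ 2 := by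
  obtain ⟨ε, hε, h⟩ := exists_besselJ_ne_zero m
  rw [← two_mul_integral_besselJ_sq]
  have hc : Continuous fun x => 2 * x * besselJ m x ^ 2 := by fun_prop
  refine intervalIntegral.integral_pos hz hc.continuousOn
    (fun x hx => by have := hx.1; positivity) ⟨min z (ε / 2), ⟨by positivity, min_le_left _ _⟩, ?_⟩
  have h1 : 0 < min z (ε / 2) := by positivity
  have h2 := h _ ⟨h1, (min_le_right _ _).trans_lt (half_lt_self hε)⟩
  positivity

theorem besselJ'_zero_zero : besselJ' 0 0 = 0 := by
  simp [besselJ'_eq_integral]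

/-- At a critical point the positive energy reduces to `(z² - m²) J_m(z)²`. -/
theorem sq_sub_sq_pos_and_besselJ_ne_zero {m : ℤ} {z : ℝ} (hz : 0 < z) (h : besselJ' m z = 0) :
    0 < z ^ 2 - (m : ℝ) ^ 2 ∧ besselJ m z ≠ 0 := by
  have := besselJ_energy_pos m hz
  rw [h, mul_zero, zero_pow two_ne_zero, zero_add] at this
  have h2 : besselJ m z ≠ 0 := by
    intro h0
    simp [h0] at this
  exact ⟨pos_of_mul_pos_left this (sq_nonneg _), h2⟩

/-! ### The set of admissible critical points. -/

/-- Positive critical points exceed `|m|`, and at `x = 0` the bound `|m| ≤ x` says exactly `m = 0`.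
In this form the set is visibly closed. -/
theorem neumannZeroSet_eq (m : ℤ) : neumannZeroSet m = {x | |(m : ℝ)| ≤ x ∧ besselJ' m x = 0} := by
  ext x
  constructor
  · rintro ⟨h0, h1, h2⟩
    refine ⟨?_, h1⟩
    rcases h0.eq_or_lt with rfl | h
    · simp [h2 rfl]
    · exact abs_le_of_sq_le_sq' (by linarith [(sq_sub_sq_pos_and_besselJ_ne_zero h h1).1]) h.le
        |> abs_le.2
  · rintro ⟨h0, h1⟩
    refine ⟨(abs_nonneg _).trans h0, h1, ?_⟩
    rintro rfl
    exact_mod_cast abs_nonpos_iff.1 h0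

theorem isClosed_neumannZeroSet (m : ℤ) : IsClosed (neumannZeroSet m) := by
  rw [neumannZeroSet_eq]
  exact (isClosed_le continuous_const continuous_id).inter
    (isClosed_eq (continuous_besselJ' m) continuous_const)

theorem besselJ_ne_zero_of_mem {m : ℤ} {z : ℝ} (hz : z ∈ neumannZeroSet m) : besselJ m z ≠ 0 := by
  rcases hz.1.eq_or_lt with rfl | h
  · simp [hz.2.2 rfl, besselJ_zero_zero]
  · exact (sq_sub_sq_pos_and_besselJ_ne_zero h hz.2.1).2

theorem abs_le_of_mem_neumannZeroSet {m : ℤ} {z : ℝ} (hz : z ∈ neumannZeroSet m) :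
    |(m : ℝ)| ≤ z := by
  rw [neumannZeroSet_eq] at hz
  exact hz.1

/-- Bessel's equation reads `(x J_m')' = ((m² - x²)/x) J_m`, whose coefficient is negative beyond
`|m|`. The constant `c` carries the sign of `J_m`. -/
theorem strictAntiOn_mul_besselJ' {m : ℤ} {c z : ℝ} {s : Set ℝ} (hs : Convex ℝ s)
    (hm : |(m : ℝ)| ≤ z) (hz : s ⊆ Set.Ici z) (h : ∀ x ∈ interior s, 0 < c * besselJ m x) :
    StrictAntiOn (fun x => c * (x * besselJ' m x)) s := by
  refine strictAntiOn_of_deriv_neg hs (by fun_prop) fun x hx => ?_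
  have hx' : x ∈ Set.Ioi z := by
    rw [← interior_Ici]
    exact interior_mono hz hx
  have h0 : |(m : ℝ)| < x := hm.trans_lt hx'
  have hx0 : 0 < x := (abs_nonneg _).trans_lt h0
  rw [((hasDerivAt_mul_besselJ' m hx0.ne').const_mul c).deriv, mul_left_comm]
  refine mul_neg_of_neg_of_pos (div_neg_of_neg_of_pos ?_ hx0) (h x hx)
  have := sq_lt_sq' (by linarith [abs_nonneg (m : ℝ)]) h0
  rw [sq_abs] at this
  linarith

theorem besselJ'_forall_pos_or_forall_neg {m : ℤ} {s : Set ℝ} (hs : Convex ℝ s)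
    (h : ∀ x ∈ s, besselJ' m x ≠ 0) :
    (∀ x ∈ s, besselJ' m x < 0) ∨ ∀ x ∈ s, 0 < besselJ' m x :=
  hasDerivWithinAt_forall_lt_or_forall_gt_of_forall_ne hs
    (fun x _ => (hasDerivAt_besselJ m x).hasDerivWithinAt) h

theorem exists_sign_besselJ_eventually_pos {m : ℤ} {X : ℝ}
    (h : ∀ x ∈ Set.Ioi X, besselJ' m x ≠ 0) :
    ∃ c : ℝ, ∃ Y > X, ∀ x ∈ Set.Ioi Y, 0 < c * besselJ m x := by
  obtain ⟨d, hd⟩ : ∃ d : ℝ, ∀ x ∈ Set.Ioi X, 0 < d * besselJ' m x := by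
    rcases besselJ'_forall_pos_or_forall_neg (convex_Ioi X) h with h | h
    · exact ⟨-1, fun x hx => by linarith [h x hx]⟩
    · exact ⟨1, fun x hx => by linarith [h x hx]⟩
  have hm : StrictMonoOn (fun x => d * besselJ m x) (Set.Ioi X) := by
    refine strictMonoOn_of_deriv_pos (convex_Ioi X) (by fun_prop) fun x hx => ?_
    rw [interior_Ioi] at hx
    rw [((hasDerivAt_besselJ m x).const_mul d).deriv]
    exact hd x hx
  by_cases hy : ∃ y > X, 0 ≤ d * besselJ m y
  · obtain ⟨y, hy, h0⟩ := hy
    exact ⟨d, y, hy, fun x hx => h0.trans_lt (hm hy (lt_trans hy hx) hx)⟩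
  · push Not at hy
    exact ⟨-d, X + 1, by linarith, fun x hx => by
      have := hy x (lt_trans (lt_add_one X) hx)
      linarith⟩

/-- Without further critical points some `c J_m` is eventually positive, so `q = c x J_m'`
decreases. If `q` is ever negative, `c J_m` falls below a decreasing logarithm; otherwise `c J_m` is
nondecreasing, which forces `q` down at least linearly. Either way a sign is contradicted. -/
theorem exists_besselJ'_eq_zero_gt (m : ℤ) (X : ℝ) : ∃ z > X, besselJ' m z = 0 := by
  by_contra! hcon
  -- The margin `|m| + 1` ensures `(m² - x²)/x ≤ -1` later on.
  obtain ⟨c, Y, hY, hc⟩ := exists_sign_besselJ_eventually_pos (m := m)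
    (X := max X (|(m : ℝ)| + 1)) fun x hx => hcon x ((le_max_left _ _).trans_lt hx)
  have hmY : |(m : ℝ)| + 1 < Y := (le_max_right _ _).trans_lt hY
  have hY0 : 0 < Y := by linarith [abs_nonneg (m : ℝ)]
  have hanti : StrictAntiOn (fun x => c * (x * besselJ' m x)) (Set.Ici Y) :=
    strictAntiOn_mul_besselJ' (convex_Ici Y) (by linarith) subset_rfl
      (by rw [interior_Ici]; exact hc)
  by_cases hneg : ∃ y > Y, c * (y * besselJ' m y) < 0
  · obtain ⟨y, hy, hp⟩ := hneg
    have hy0 : 0 < y := hY0.trans hy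
    set p := c * (y * besselJ' m y) with hpdef
    have hA : AntitoneOn (fun x => c * besselJ m x - p * Real.log x) (Set.Ici y) := by
      have hd : ∀ x ∈ Set.Ici y, HasDerivAt (fun x => c * besselJ m x - p * Real.log x)
          (c * besselJ' m x - p * x⁻¹) x := fun x hx =>
        ((hasDerivAt_besselJ m x).const_mul c).sub
          ((Real.hasDerivAt_log (hy0.trans_le hx).ne').const_mul p)
      refine antitoneOn_of_deriv_nonpos (convex_Ici y)
        (fun x hx => (hd x hx).continuousAt.continuousWithinAt)
        (fun x hx => (hd x (interior_subset hx)).differentiableAt.differentiableWithinAt)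
        fun x hx => ?_
      have hx' := interior_subset hx
      have hx0 : 0 < x := hy0.trans_le hx'
      rw [(hd x hx').deriv]
      have := hanti.antitoneOn (Set.mem_Ici.2 hy.le) (Set.mem_Ici.2 (hy.le.trans hx')) hx'
      have h3 : c * besselJ' m x - p * x⁻¹ = (c * (x * besselJ' m x) - p) / x := by
        field_simp
      rw [h3]
      exact div_nonpos_of_nonpos_of_nonneg (sub_nonpos.2 this) hx0.le
    -- At `y exp(-c J_m(y)/p)` the logarithmic upper bound for `c J_m` reaches zero.
    have hT : 0 < -(c * besselJ m y) / p := div_pos_of_neg_of_neg (by linarith [hc y hy]) hp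
    have hle : y ≤ y * Real.exp (-(c * besselJ m y) / p) :=
      le_mul_of_one_le_right hy0.le (Real.one_le_exp hT.le)
    have h1 := hA Set.self_mem_Ici hle hle
    have h2 := hc _ (lt_of_lt_of_le hy hle)
    simp only [Real.log_mul hy0.ne' (Real.exp_ne_zero _), Real.log_exp, mul_add,
      mul_div_cancel₀ _ hp.ne] at h1
    linarith
  · push Not at hneg
    have hy : Y < Y + 1 := lt_add_one Y
    set y := Y + 1
    have hmono : MonotoneOn (fun x => c * besselJ m x) (Set.Ici y) := by
      refine monotoneOn_of_deriv_nonneg (convex_Ici y) (by fun_prop)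
        (fun x _ => ((hasDerivAt_besselJ m x).const_mul c).differentiableAt.differentiableWithinAt)
        fun x hx => ?_
      have hx' : Y < x := lt_of_lt_of_le hy (Set.mem_Ici.1 (interior_subset hx))
      rw [((hasDerivAt_besselJ m x).const_mul c).deriv]
      have := hneg x hx'
      rw [mul_left_comm] at this
      exact nonneg_of_mul_nonneg_right this (hY0.trans hx')
    have hy0 := hc y hy
    have hA : AntitoneOn (fun x => c * (x * besselJ' m x) + c * besselJ m y * x) (Set.Ici y) := by
      have hd : ∀ x ∈ Set.Ici y,
          HasDerivAt (fun x => c * (x * besselJ' m x) + c * besselJ m y * x)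
          (c * ((m ^ 2 - x ^ 2) / x * besselJ m x) + c * besselJ m y * 1) x := fun x hx =>
        ((hasDerivAt_mul_besselJ' m (hY0.trans (lt_of_lt_of_le hy hx)).ne').const_mul c).add
          ((hasDerivAt_id x).const_mul _)
      refine antitoneOn_of_deriv_nonpos (convex_Ici y)
        (fun x hx => (hd x hx).continuousAt.continuousWithinAt)
        (fun x hx => (hd x (interior_subset hx)).differentiableAt.differentiableWithinAt)
        fun x hx => ?_
      have hx' := interior_subset hx
      have hx1 : |(m : ℝ)| + 1 < x := hmY.trans (lt_of_lt_of_le hy hx')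
      have hx0 : 0 < x := by linarith [abs_nonneg (m : ℝ)]
      rw [(hd x hx').deriv]
      have h1 : (m ^ 2 - x ^ 2) / x ≤ -1 := by
        rw [div_le_iff₀ hx0, ← sq_abs (m : ℝ)]
        nlinarith [abs_nonneg (m : ℝ)]
      have h2 := hmono Set.self_mem_Ici hx' hx'
      simp only at h2
      nlinarith
    -- One unit past the point where the linear bound on `q` reaches zero.
    have hq : 0 ≤ c * (y * besselJ' m y) / (c * besselJ m y) := div_nonneg (hneg y hy) hy0.le
    have hle : y ≤ y + (c * (y * besselJ' m y) / (c * besselJ m y) + 1) := by linarith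
    have h1 := hA Set.self_mem_Ici hle hle
    have h2 := hneg _ (lt_of_lt_of_le hy hle)
    simp only [mul_add (c * besselJ m y), mul_div_cancel₀ _ hy0.ne'] at h1
    linarith

theorem exists_mem_neumannZeroSet_gt (m : ℤ) (X : ℝ) : ∃ z ∈ neumannZeroSet m, X < z := by
  obtain ⟨z, hz, h⟩ := exists_besselJ'_eq_zero_gt m (max X |(m : ℝ)|)
  rw [neumannZeroSet_eq]
  exact ⟨z, ⟨(le_max_right _ _).trans hz.le, h⟩, (le_max_left _ _).trans_lt hz⟩

/-- Since `J_m(z) ≠ 0`, the sign of `J_m` persists just after `z`; there `x J_m'` is strictly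
monotone and cannot return to zero. -/
theorem exists_gap_neumannZeroSet {m : ℤ} {z : ℝ} (hz : z ∈ neumannZeroSet m) :
    ∃ w > z, ∀ x ∈ Set.Ioo z w, x ∉ neumannZeroSet m := by
  have hpos : 0 < besselJ m z * besselJ m z := mul_self_pos.2 (besselJ_ne_zero_of_mem hz)
  have hev : ∀ᶠ x in nhds z, 0 < besselJ m z * besselJ m x :=
    (continuous_const.mul (continuous_besselJ m)).continuousAt.eventually (lt_mem_nhds hpos)
  obtain ⟨ε, hε, h⟩ := Metric.eventually_nhds_iff_ball.1 hev
  refine ⟨z + ε, by linarith, fun x hx hx' => ?_⟩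
  have := strictAntiOn_mul_besselJ' (c := besselJ m z) (convex_Icc z x)
    (abs_le_of_mem_neumannZeroSet hz) (fun y hy => hy.1) (fun y hy => ?_)
    (Set.left_mem_Icc.2 hx.1.le) (Set.right_mem_Icc.2 hx.1.le) hx.1
  · simp [hz.2.1, hx'.2.1] at this
  · rw [interior_Icc] at hy
    refine h y ?_
    rw [Metric.mem_ball, Real.dist_eq, abs_of_pos (sub_pos.2 hy.1)]
    linarith [hx.2, hy.2]

theorem csInf_neumannZeroSet_gt {m : ℤ} {z : ℝ} (hz : z ∈ neumannZeroSet m) :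
    sInf {x | x ∈ neumannZeroSet m ∧ z < x} ∈ {x | x ∈ neumannZeroSet m ∧ z < x} := by
  obtain ⟨w, hw, h⟩ := exists_gap_neumannZeroSet hz
  have heq : {x | x ∈ neumannZeroSet m ∧ z < x} = neumannZeroSet m ∩ Set.Ici w := by
    ext x
    refine ⟨fun hx => ⟨hx.1, ?_⟩, fun hx => ⟨hx.1, lt_of_lt_of_le hw hx.2⟩⟩
    by_contra hlt
    exact h x ⟨hx.2, not_le.1 hlt⟩ hx.1
  obtain ⟨y, hy, hy'⟩ := exists_mem_neumannZeroSet_gt m w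
  rw [heq]
  exact ((isClosed_neumannZeroSet m).inter isClosed_Ici).csInf_mem ⟨y, hy, hy'.le⟩
    ⟨w, fun x hx => hx.2⟩

theorem bddBelow_neumannZeroSet (m : ℤ) : BddBelow (neumannZeroSet m) := ⟨0, fun _ hx => hx.1⟩

theorem neumannZero_succ_mem (m : ℤ) (n : ℕ) : neumannZero m (n + 1) ∈ neumannZeroSet m := by
  induction n with
  | zero =>
    obtain ⟨y, hy, -⟩ := exists_mem_neumannZeroSet_gt m 0
    exact (isClosed_neumannZeroSet m).csInf_mem ⟨y, hy⟩ (bddBelow_neumannZeroSet m)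
  | succ k ih => exact (csInf_neumannZeroSet_gt ih).1

theorem neumannZero_lt_succ (m : ℤ) (n : ℕ) : neumannZero m (n + 1) < neumannZero m (n + 2) :=
  (csInf_neumannZeroSet_gt (neumannZero_succ_mem m n)).2

theorem notMem_neumannZeroSet_of_mem_Ioo {m : ℤ} {n : ℕ} {x : ℝ}
    (hx : x ∈ Set.Ioo (neumannZero m (n + 1)) (neumannZero m (n + 2))) :
    x ∉ neumannZeroSet m := fun h =>
  not_le.2 hx.2 (csInf_le ⟨0, fun _ hy => hy.1.1⟩ ⟨h, hx.1⟩)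

/-! ### Signs of the Bessel function at its critical points. -/

/-- Were the signs equal, `J_m`, monotone in between, would keep that sign throughout; then `x J_m'`
would be strictly monotone yet vanish at both ends. -/
theorem besselJ_mul_besselJ_neg_of_consecutive {m : ℤ} {z w : ℝ} (hz : z ∈ neumannZeroSet m)
    (hw : w ∈ neumannZeroSet m) (hzw : z < w) (h : ∀ x ∈ Set.Ioo z w, x ∉ neumannZeroSet m) :
    besselJ m z * besselJ m w < 0 := by
  have hz0 := besselJ_ne_zero_of_mem hz
  have hw0 := besselJ_ne_zero_of_mem hw
  by_contra hcon
  have hpos : 0 < besselJ m z * besselJ m w :=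
    lt_of_le_of_ne (not_lt.1 hcon) (mul_ne_zero hz0 hw0).symm
  have hne : ∀ x ∈ Set.Ioo z w, besselJ' m x ≠ 0 := fun x hx hx0 => h x hx (by
    rw [neumannZeroSet_eq]
    exact ⟨(abs_le_of_mem_neumannZeroSet hz).trans hx.1.le, hx0⟩)
  have hbetween : ∀ x ∈ Set.Ioo z w, 0 < besselJ m z * besselJ m x := by
    have hzz : 0 < besselJ m z * besselJ m z := mul_self_pos.2 hz0
    intro x hx
    rcases besselJ'_forall_pos_or_forall_neg (convex_Ioo z w) hne with hs | hs
    · have hmono : StrictAntiOn (besselJ m) (Set.Icc z w) :=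
        strictAntiOn_of_deriv_neg (convex_Icc z w) (by fun_prop) fun y hy => by
          rw [interior_Icc] at hy
          exact hs y hy
      have h1 := hmono (Set.left_mem_Icc.2 hzw.le) (Set.Ioo_subset_Icc_self hx) hx.1
      have h2 := hmono (Set.Ioo_subset_Icc_self hx) (Set.right_mem_Icc.2 hzw.le) hx.2
      rcases hz0.lt_or_gt with h3 | h3 <;> nlinarith
    · have hmono : StrictMonoOn (besselJ m) (Set.Icc z w) :=
        strictMonoOn_of_deriv_pos (convex_Icc z w) (by fun_prop) fun y hy => by
          rw [interior_Icc] at hy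
          exact hs y hy
      have h1 := hmono (Set.left_mem_Icc.2 hzw.le) (Set.Ioo_subset_Icc_self hx) hx.1
      have h2 := hmono (Set.Ioo_subset_Icc_self hx) (Set.right_mem_Icc.2 hzw.le) hx.2
      rcases hz0.lt_or_gt with h3 | h3 <;> nlinarith
  have := strictAntiOn_mul_besselJ' (c := besselJ m z) (convex_Icc z w)
    (abs_le_of_mem_neumannZeroSet hz) (fun y hy => hy.1)
    (by rw [interior_Icc]; exact hbetween)
    (Set.left_mem_Icc.2 hzw.le) (Set.right_mem_Icc.2 hzw.le) hzw
  simp [hz.2.1, hw.2.1] at this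

theorem neumannZero_zero_one : neumannZero 0 1 = 0 := by
  refine le_antisymm (csInf_le (bddBelow_neumannZeroSet 0) ?_) (neumannZero_succ_mem 0 0).1
  exact ⟨le_rfl, besselJ'_zero_zero, fun _ => rfl⟩

/-- For `m > 0`, `J_m` starts from `0`, is positive just after it and has no critical point before
the first zero, so it increases up to there. -/
theorem besselJ_natCast_neumannZero_one_pos (m : ℕ) : 0 < besselJ m (neumannZero m 1) := by
  rcases Nat.eq_zero_or_pos m with rfl | hm
  · simp [neumannZero_zero_one, besselJ_zero_zero]
  have hm0 : (m : ℤ) ≠ 0 := by exact_mod_cast hm.ne'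
  have hz := neumannZero_succ_mem m 0
  rw [zero_add] at hz
  have hzpos : 0 < neumannZero m 1 := lt_of_le_of_ne hz.1 fun h => hm0 (hz.2.2 h.symm)
  have hne : ∀ x ∈ Set.Ioo 0 (neumannZero m 1), besselJ' m x ≠ 0 := fun x hx hx0 =>
    not_le.2 hx.2 (csInf_le (bddBelow_neumannZeroSet m)
      ⟨hx.1.le, hx0, fun h => absurd h hx.1.ne'⟩)
  have h0 := besselJ_zero_right hm0
  rcases besselJ'_forall_pos_or_forall_neg (convex_Ioo _ _) hne with hs | hs
  · have hmono : StrictAntiOn (besselJ m) (Set.Icc 0 (neumannZero m 1)) :=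
      strictAntiOn_of_deriv_neg (convex_Icc _ _) (by fun_prop) fun y hy => by
        rw [interior_Icc] at hy
        exact hs y hy
    obtain ⟨ε, hε, h⟩ := exists_besselJ_natCast_pos
    have h1 : 0 < min (neumannZero m 1) (ε / 2) := by positivity
    have h2 := h m _ ⟨h1, (min_le_right _ _).trans_lt (half_lt_self hε)⟩
    have h3 := hmono (Set.left_mem_Icc.2 hzpos.le) ⟨h1.le, min_le_left _ _⟩ h1
    rw [h0] at h3
    exact absurd h3 h2.le.not_gt
  · have hmono : StrictMonoOn (besselJ m) (Set.Icc 0 (neumannZero m 1)) :=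
      strictMonoOn_of_deriv_pos (convex_Icc _ _) (by fun_prop) fun y hy => by
        rw [interior_Icc] at hy
        exact hs y hy
    have := hmono (Set.left_mem_Icc.2 hzpos.le) (Set.right_mem_Icc.2 hzpos.le) hzpos
    rwa [h0] at this

theorem neg_one_pow_mul_besselJ_natCast_neumannZero_pos (m n : ℕ) :
    0 < (-1) ^ n * besselJ m (neumannZero m (n + 1)) := by
  induction n with
  | zero => simpa using besselJ_natCast_neumannZero_one_pos m
  | succ k ih =>
    have h := besselJ_mul_besselJ_neg_of_consecutive (neumannZero_succ_mem m k)
      (neumannZero_succ_mem m (k + 1)) (neumannZero_lt_succ m k)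
      fun x hx => notMem_neumannZeroSet_of_mem_Ioo hx
    rw [pow_succ]
    rcases neg_one_pow_eq_or ℝ k with h1 | h1 <;> rw [h1] at ih ⊢ <;> nlinarith

theorem besselJ'_neg_order (m : ℤ) (x : ℝ) : besselJ' (-m) x = (-1) ^ m * besselJ' m x := by
  have h := (hasDerivAt_besselJ m x).const_mul ((-1 : ℝ) ^ m)
  exact (h.congr_of_eventuallyEq
    (Filter.Eventually.of_forall fun y => besselJ_neg_order m y)).deriv

theorem neumannZeroSet_neg (m : ℤ) : neumannZeroSet (-m) = neumannZeroSet m := by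
  ext x
  simp [neumannZeroSet, besselJ'_neg_order, zpow_ne_zero]

theorem neumannZero_neg (m : ℤ) (n : ℕ) : neumannZero (-m) n = neumannZero m n := by
  match n with
  | 0 => rfl
  | 1 => simp only [neumannZero, neumannZeroSet_neg]
  | n + 2 => simp only [neumannZero, neumannZeroSet_neg, neumannZero_neg m (n + 1)]

/-- The sign of `J_m` at the zeros of its derivative, with the phase of `J_{-m} = (-1)^m J_m`. -/
theorem I_zpow_mul_besselJ_neumannZero (m : ℤ) (n : ℕ) :
    Complex.I ^ m * (besselJ m (neumannZero m (n + 1)) : ℂ) =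
      Complex.I ^ m.natAbs * (-1) ^ n * (|besselJ m (neumannZero m (n + 1))| : ℝ) := by
  have key : ∀ k : ℕ, besselJ k (neumannZero k (n + 1)) =
      (-1) ^ n * |besselJ k (neumannZero k (n + 1))| := fun k => by
    have h := neg_one_pow_mul_besselJ_natCast_neumannZero_pos k n
    rcases neg_one_pow_eq_or ℝ n with h1 | h1 <;> rw [h1] at h ⊢
    · rw [abs_of_pos (by linarith)]; ring
    · rw [abs_of_neg (by linarith)]; ring
  obtain ⟨k, rfl | rfl⟩ := m.eq_nat_or_neg
  · conv_lhs => rw [key k]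
    push_cast
    simp only [zpow_natCast, Int.natAbs_natCast]
    ring
  · rw [neumannZero_neg, besselJ_neg_order, abs_mul]
    conv_lhs => rw [key k]
    have hI : Complex.I ^ (-(k : ℤ)) * (-1) ^ k = Complex.I ^ k := by
      rw [zpow_neg, zpow_natCast, ← inv_pow, ← mul_pow]
      simp
    simp only [zpow_natCast, Int.natAbs_neg, Int.natAbs_natCast, abs_pow, abs_neg, abs_one,
      one_pow, one_mul]
    push_cast
    rw [← hI]
    ring

/-! ### Lommel's radial integral. -/

/-- Lagrange's identity: `J_m(zs)` and `J_m(ts)` solve the same Sturm–Liouville equation with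
eigenvalues `z²` and `t²`. -/
theorem hasDerivAt_lommel (m : ℤ) (z t : ℝ) {s : ℝ} (hs : s ≠ 0) :
    HasDerivAt (fun s => besselJ m (z * s) * (t * s * besselJ' m (t * s)) -
        z * s * besselJ' m (z * s) * besselJ m (t * s))
      ((z ^ 2 - t ^ 2) * (besselJ m (z * s) * besselJ m (t * s) * s)) s := by
  have hlin : ∀ y : ℝ, HasDerivAt (fun s : ℝ => y * s) y s := fun y => by
    simpa using (hasDerivAt_id s).const_mul y
  have hJ : ∀ y : ℝ, HasDerivAt (fun s => besselJ m (y * s)) (besselJ' m (y * s) * y) s :=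
    fun y => (hasDerivAt_besselJ m (y * s)).comp s (hlin y)
  have hp : ∀ y : ℝ, HasDerivAt (fun s => y * s * besselJ' m (y * s))
      ((m ^ 2 - (y * s) ^ 2) / s * besselJ m (y * s)) s := fun y => by
    convert! (hlin y).mul ((hasDerivAt_besselJ' m (y * s)).comp s (hlin y)) using 1
    simp only [Function.comp_apply]
    field_simp
    linear_combination (-1 : ℝ) * besselJ_ode m (y * s)
  convert! ((hJ z).mul (hp t)).sub ((hp z).mul (hJ t)) using 1
  field_simp
  ring

theorem integral_besselJ_mul_besselJ_of_mem {m : ℤ} {z : ℝ} (hz : z ∈ neumannZeroSet m) {t : ℝ}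
    (ht : 0 ≤ t) : ∫ s in (0 : ℝ)..1, besselJ m (z * s) * besselJ m (t * s) * s =
      besselJ m z * neumannQuotient m z t := by
  unfold neumannQuotient
  split_ifs with h1 h2
  · have hne : z ^ 2 - t ^ 2 ≠ 0 := by
      rw [sub_ne_zero, Ne, sq_eq_sq₀ hz.1 ht]
      exact h1.symm
    have h := intervalIntegral.integral_eq_sub_of_hasDerivAt_of_le (zero_le_one' ℝ)
      (by fun_prop) (fun s hs => hasDerivAt_lommel m z t hs.1.ne')
      ((by fun_prop : Continuous fun s : ℝ =>
        (z ^ 2 - t ^ 2) * (besselJ m (z * s) * besselJ m (t * s) * s)).intervalIntegrable _ _)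
    rw [intervalIntegral.integral_const_mul] at h
    simp only [mul_one, mul_zero, zero_mul, hz.2.1, sub_zero] at h
    rw [← mul_div_assoc, eq_div_iff hne, ← h]
    ring
  · obtain rfl := h2
    obtain rfl := hz.2.2 rfl
    obtain rfl := not_not.1 h1
    simp [besselJ_zero_zero]
  · obtain rfl := not_not.1 h1
    -- On the diagonal Lommel's identity is void; the energy integral replaces it, and Bessel's
    -- equation at the critical point turns `(t² - m²) J_m` into `-t² J_m''`.
    have h := intervalIntegral.integral_comp_mul_left (fun x => 2 * x * besselJ m x ^ 2) h2
      (a := 0) (b := 1)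
    rw [mul_zero, mul_one, two_mul_integral_besselJ_sq, hz.2.1, smul_eq_mul] at h
    have h3 : ∀ s : ℝ, 2 * (t * s) * besselJ m (t * s) ^ 2 =
      2 * t * (besselJ m (t * s) * besselJ m (t * s) * s) := fun s => by ring
    simp only [h3, intervalIntegral.integral_const_mul] at h
    have h4 := besselJ_ode m t
    rw [hz.2.1] at h4
    have h5 : 2 * t ^ 2 * (∫ s in (0 : ℝ)..1, besselJ m (t * s) * besselJ m (t * s) * s) =
        2 * t ^ 2 * (besselJ m t * (-besselJ'' m t / 2)) := by
      have h6 : t * t⁻¹ = 1 := mul_inv_cancel₀ h2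
      linear_combination t * h + (t ^ 2 - m ^ 2) * besselJ m t ^ 2 * h6 + besselJ m t * h4
    exact mul_left_cancel₀ (by positivity) h5

theorem integral_besselJ_div_mul_besselJ_div {a : ℝ} (ha : 0 < a) {m : ℤ} {z : ℝ}
    (hz : z ∈ neumannZeroSet m) {t : ℝ} (ht : 0 ≤ t) :
    ∫ r in (0 : ℝ)..a, besselJ m (z / a * r) * besselJ m (t / a * r) * r =
      a ^ 2 * (besselJ m z * neumannQuotient m z t) := by
  have h := intervalIntegral.integral_comp_mul_left
    (fun r => besselJ m (z / a * r) * besselJ m (t / a * r) * r) ha.ne' (a := 0) (b := 1)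
  rw [mul_zero, mul_one, smul_eq_mul] at h
  have h3 : ∀ s : ℝ, besselJ m (z / a * (a * s)) * besselJ m (t / a * (a * s)) * (a * s) =
      a * (besselJ m (z * s) * besselJ m (t * s) * s) := fun s => by
    rw [← mul_assoc (z / a), ← mul_assoc (t / a), div_mul_cancel₀ _ ha.ne',
      div_mul_cancel₀ _ ha.ne']
    ring
  simp only [h3, intervalIntegral.integral_const_mul,
    integral_besselJ_mul_besselJ_of_mem hz ht] at h
  rw [eq_inv_mul_iff_mul_eq₀ ha.ne'] at h
  rw [← h]
  ring

/-! ### The angular integral, normalization and lattice angle. -/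

theorem exp_neg_I_mul_int_two_pi (m : ℤ) (x : ℂ) :
    Complex.exp (-(Complex.I * m * (x + 2 * Real.pi))) = Complex.exp (-(Complex.I * m * x)) := by
  rw [show -(Complex.I * m * (x + 2 * Real.pi)) = -(Complex.I * m * x) +
    (-m : ℤ) * (2 * Real.pi * Complex.I) by push_cast; ring, Complex.exp_add,
    Complex.exp_int_mul_two_pi_mul_I, mul_one]

/-- Bessel's integral in exponential form. -/
theorem integral_exp_phase (m : ℤ) (x : ℝ) :
    ∫ τ in (-Real.pi)..Real.pi,
      Complex.exp (-(Complex.I * m * τ)) * Complex.exp (Complex.I * (x * Real.sin τ : ℝ)) =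
      2 * Real.pi * besselJ m x := by
  set g : ℝ → ℂ := fun τ =>
    Complex.exp (-(Complex.I * m * τ)) * Complex.exp (Complex.I * (x * Real.sin τ : ℝ))
  have hg : Continuous g := by fun_prop
  have hgi : ∀ u v : ℝ, IntervalIntegrable g volume u v := fun u v => hg.intervalIntegrable u v
  have h1 := intervalIntegral.integral_comp_neg g (a := 0) (b := Real.pi)
  rw [neg_zero] at h1
  rw [← intervalIntegral.integral_add_adjacent_intervals (hgi _ 0) (hgi 0 _), ← h1,
    ← intervalIntegral.integral_add
      ((by fun_prop : Continuous fun τ => g (-τ)).intervalIntegrable _ _) (hgi _ _)]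
  have h2 : ∀ τ : ℝ, g (-τ) + g τ = ((2 * Real.cos (m * τ - x * Real.sin τ) : ℝ) : ℂ) := by
    intro τ
    simp only [g, ← Complex.exp_add]
    push_cast
    rw [Complex.two_cos]
    simp only [Complex.sin_neg]
    congr 2 <;> ring
  simp only [h2]
  rw [intervalIntegral.integral_ofReal, intervalIntegral.integral_const_mul, besselJ]
  have := Real.pi_ne_zero
  push_cast
  field_simp

/-- By periodicity one may put `θ = τ + φ - π/2`; the cosine becomes `sin τ` and the quarter turn
contributes `i^m`. -/
theorem integral_exp_mul_exp_cos (m : ℤ) (x φ : ℝ) :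
    ∫ θ in (0 : ℝ)..(2 * Real.pi),
      Complex.exp (-(Complex.I * m * θ)) * Complex.exp (Complex.I * (x * Real.cos (θ - φ) : ℝ)) =
      2 * Real.pi * (Complex.I ^ m * Complex.exp (-(Complex.I * m * φ)) * besselJ m x) := by
  set h : ℝ → ℂ := fun θ =>
    Complex.exp (-(Complex.I * m * θ)) * Complex.exp (Complex.I * (x * Real.cos (θ - φ) : ℝ))
    with hh
  have hper : Function.Periodic h (2 * Real.pi) := fun θ => by
    simp only [hh]
    rw [show θ + 2 * Real.pi - φ = θ - φ + 2 * Real.pi by ring, Real.cos_add_two_pi]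
    have := exp_neg_I_mul_int_two_pi m θ
    push_cast at this ⊢
    rw [this]
  have h1 := hper.intervalIntegral_add_eq 0 (-Real.pi + (φ - Real.pi / 2))
  rw [zero_add] at h1
  rw [h1, show -Real.pi + (φ - Real.pi / 2) + 2 * Real.pi = Real.pi + (φ - Real.pi / 2) by ring,
    ← intervalIntegral.integral_comp_add_right]
  have h2 : ∀ τ : ℝ, h (τ + (φ - Real.pi / 2)) =
      Complex.I ^ m * Complex.exp (-(Complex.I * m * φ)) *
        (Complex.exp (-(Complex.I * m * τ)) * Complex.exp (Complex.I * (x * Real.sin τ : ℝ))) := by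
    intro τ
    have hI : Complex.I ^ m = Complex.exp (Complex.I * m * (Real.pi / 2)) := by
      rw [mul_comm Complex.I, mul_assoc, Complex.exp_int_mul, mul_comm Complex.I,
        Complex.exp_pi_div_two_mul_I]
    simp only [hh]
    rw [show τ + (φ - Real.pi / 2) - φ = τ - Real.pi / 2 by ring, Real.cos_sub_pi_div_two, hI,
      ← Complex.exp_add, ← Complex.exp_add, ← Complex.exp_add, ← Complex.exp_add]
    congr 1
    push_cast
    ring
  simp only [h2]
  rw [intervalIntegral.integral_const_mul, integral_exp_phase]
  ring

/-- The norm is a perfect square involving `|J_m(z)|`, so its root loses the sign of `J_m(z)`, which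
is restored by `I_zpow_mul_besselJ_neumannZero`. -/
theorem inv_sqrt_neumannNorm_mul_abs_besselJ {a : ℝ} (ha : 0 < a) (m : ℤ) (n : ℕ) :
    1 / Real.sqrt (neumannNorm a (n + 1) m) * |besselJ m (neumannZero m (n + 1))| =
      Real.sqrt 2 * neumannAmplitude a (n + 1) m := by
  have hz := neumannZero_succ_mem m n
  have h2 : Real.sqrt 2 ≠ 0 := by positivity
  unfold neumannNorm neumannAmplitude
  split_ifs with h
  · have hm := hz.2.2 h
    subst hm
    rw [h, besselJ_zero_zero, Real.sqrt_div (sq_nonneg a), Real.sqrt_sq ha.le]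
    field_simp
    simp
  · have hzpos : 0 < neumannZero m (n + 1) := lt_of_le_of_ne hz.1 (Ne.symm h)
    obtain ⟨h3, h4⟩ := sq_sub_sq_pos_and_besselJ_ne_zero hzpos hz.2.1
    set z := neumannZero m (n + 1)
    have h5 : a ^ 2 / 2 * (1 - (m : ℝ) ^ 2 / z ^ 2) * besselJ m z ^ 2 =
        (a / Real.sqrt 2 * (Real.sqrt (z ^ 2 - m ^ 2) / z) * |besselJ m z|) ^ 2 := by
      rw [mul_pow, mul_pow, div_pow, div_pow, sq_abs, Real.sq_sqrt h3.le,
        Real.sq_sqrt zero_le_two]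
      field_simp
    have h6 := Real.sqrt_pos.2 h3
    have h7 := abs_pos.2 h4
    rw [h5, Real.sqrt_sq (by positivity)]
    field_simp

theorem latticeNorm_mul_cos_sub_latticeAngle (k : ℤ × ℤ) (θ : ℝ) :
    latticeNorm k * Real.cos (θ - latticeAngle k) = k.1 * Real.cos θ + k.2 * Real.sin θ := by
  set w : ℂ := (k.1 : ℂ) + (k.2 : ℂ) * Complex.I with hw
  have hcast : w = ((k.1 : ℝ) : ℂ) + ((k.2 : ℝ) : ℂ) * Complex.I := by simp [hw]
  have hnorm : ‖w‖ = latticeNorm k := by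
    rw [hcast, Complex.norm_add_mul_I, latticeNorm]
  have hre : w.re = k.1 := by rw [hcast]; simp
  have him : w.im = k.2 := by rw [hcast]; simp
  have hc : Real.cos (latticeAngle k) = Real.cos w.arg := by
    unfold latticeAngle
    split_ifs <;> simp [hw]
  have hs : Real.sin (latticeAngle k) = Real.sin w.arg := by
    unfold latticeAngle
    split_ifs <;> simp [hw]
  have h1 := Complex.norm_mul_cos_arg w
  have h2 := Complex.norm_mul_sin_arg w
  rw [hnorm, hre] at h1
  rw [hnorm, him] at h2
  rw [Real.cos_sub, hc, hs, ← h1, ← h2]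
  ring

/-! ### Polar coordinates on the disk. -/

theorem isCompact_planarDisk (a : ℝ) : IsCompact (planarDisk a) := by
  refine Metric.isCompact_of_isClosed_isBounded
    (isClosed_le (by fun_prop) continuous_const) ?_
  refine (Metric.isBounded_closedBall (x := (0 : ℝ × ℝ)) (r := |a|)).subset fun p hp => ?_
  have hp' : p.1 ^ 2 + p.2 ^ 2 ≤ a ^ 2 := hp
  rw [mem_closedBall_zero_iff, Prod.norm_def, sup_le_iff, Real.norm_eq_abs, Real.norm_eq_abs]
  exact ⟨sq_le_sq.1 (by nlinarith [sq_nonneg p.2]), sq_le_sq.1 (by nlinarith [sq_nonneg p.1])⟩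

theorem measurableSet_planarDisk (a : ℝ) : MeasurableSet (planarDisk a) :=
  (isCompact_planarDisk a).measurableSet

instance isFiniteMeasure_restrict_planarDisk (a : ℝ) :
    IsFiniteMeasure (volume.restrict (planarDisk a)) :=
  ⟨by rw [Measure.restrict_apply_univ]; exact (isCompact_planarDisk a).measure_lt_top⟩

theorem polar_mem_planarDisk_iff {a r : ℝ} (ha : 0 ≤ a) (hr : 0 < r) (θ : ℝ) :
    (r * Real.cos θ, r * Real.sin θ) ∈ planarDisk a ↔ r ≤ a := by
  have h : (r * Real.cos θ) ^ 2 + (r * Real.sin θ) ^ 2 = r ^ 2 := by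
    linear_combination r ^ 2 * Real.cos_sq_add_sin_sq θ
  change (r * Real.cos θ) ^ 2 + (r * Real.sin θ) ^ 2 ≤ a ^ 2 ↔ r ≤ a
  rw [h, sq_le_sq₀ hr.le ha]

theorem setIntegral_planarDisk_eq {a : ℝ} (ha : 0 ≤ a) {F : ℝ × ℝ → ℂ}
    (hF : IntegrableOn F (planarDisk a)) :
    ∫ p in planarDisk a, F p = ∫ r in (0 : ℝ)..a, ∫ θ in (0 : ℝ)..(2 * Real.pi),
      F (r * Real.cos θ, r * Real.sin θ) * r := by
  set T : Set (ℝ × ℝ) := Set.Ioc 0 a ×ˢ Set.Ioo (-Real.pi) Real.pi with hT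
  have hTm : MeasurableSet T := measurableSet_Ioc.prod measurableSet_Ioo
  have hTsub : T ⊆ polarCoord.target :=
    Set.prod_mono (fun r hr => hr.1) subset_rfl
  have hint : IntegrableOn (fun p : ℝ × ℝ => F (p.1 * Real.cos p.2, p.1 * Real.sin p.2) * p.1)
      T := by
    have h := (integrableOn_image_iff_integrableOn_abs_det_fderiv_smul volume hTm
      (fun p _ => (hasFDerivAt_polarCoord_symm p).hasFDerivWithinAt)
      (polarCoord.symm.injOn.mono hTsub) F).1 (hF.mono_set ?_)
    · refine h.congr_fun (fun p hp => ?_) hTm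
      simp only [det_fderivPolarCoordSymm, polarCoord_symm_apply]
      rw [abs_of_pos hp.1.1, Complex.real_smul, mul_comm]
    · rintro _ ⟨p, hp, rfl⟩
      exact (polar_mem_planarDisk_iff ha hp.1.1 p.2).2 hp.1.2
  have h1 : ∫ p in planarDisk a, F p =
      ∫ p in T, F (p.1 * Real.cos p.2, p.1 * Real.sin p.2) * p.1 := by
    rw [← integral_indicator (measurableSet_planarDisk a), ← integral_comp_polarCoord_symm,
      ← integral_indicator hTm, ← integral_indicator polarCoord.open_target.measurableSet]
    congr 1
    ext p
    by_cases hp : p ∈ polarCoord.target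
    · have hiff := polar_mem_planarDisk_iff ha hp.1 p.2
      rw [Set.indicator_of_mem hp]
      by_cases hpa : p.1 ≤ a
      · have hpT : p ∈ T := ⟨⟨hp.1, hpa⟩, hp.2⟩
        rw [Set.indicator_of_mem hpT, polarCoord_symm_apply, Set.indicator_of_mem (hiff.2 hpa),
          Complex.real_smul, mul_comm]
      · have hpT : p ∉ T := fun h => hpa h.1.2
        rw [Set.indicator_of_notMem hpT, polarCoord_symm_apply,
          Set.indicator_of_notMem (fun h => hpa (hiff.1 h)), smul_zero]
    · rw [Set.indicator_of_notMem hp, Set.indicator_of_notMem (fun h => hp (hTsub h))]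
  rw [h1, hT, Measure.volume_eq_prod, setIntegral_prod _ hint,
    ← intervalIntegral.integral_of_le ha]
  refine intervalIntegral.integral_congr fun r _ => ?_
  have hper : Function.Periodic
      (fun θ : ℝ => F (r * Real.cos θ, r * Real.sin θ) * r) (2 * Real.pi) := fun θ => by
    simp
  have h2 := hper.intervalIntegral_add_eq 0 (-Real.pi)
  rw [zero_add, show -Real.pi + 2 * Real.pi = Real.pi by ring] at h2
  simp only
  rw [h2, intervalIntegral.integral_of_le (by linarith [Real.pi_pos]), integral_Ioc_eq_integral_Ioo]

/-! ### Parseval's identity, transported from the torus to the disk. -/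

section

-- Total mass one, so that the characters are orthonormal on the torus.
noncomputable local instance : MeasureSpace UnitAddCircle := ⟨AddCircle.haarAddCircle⟩

open UnitAddTorus

/-- The map from the torus to the square `(-a, a]²`. -/
noncomputable def torusToSquare (a : ℝ) (t : UnitAddTorus (Fin 2)) : ℝ × ℝ :=
  (2 * a) • ((measurableEquivPiIoc (fun _ => -1 / 2) t).1 0,
    (measurableEquivPiIoc (fun _ => -1 / 2) t).1 1)

theorem map_torusToSquare {a : ℝ} (ha : 0 < a) :
    Measurable (torusToSquare a) ∧
    Measure.map (torusToSquare a) volume =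
      (ENNReal.ofReal ((4 * a ^ 2)⁻¹) • (volume : Measure (ℝ × ℝ))).restrict
        (Set.Ioc (-a) a ×ˢ Set.Ioc (-a) a) := by
  have h1 := measurePreserving_equivPiIoc (d := Fin 2) (fun _ => -1 / 2)
  have h2 : MeasurePreserving (Subtype.val :
      {x : Fin 2 → ℝ // ∀ i, x i ∈ Set.Ioc (-1 / 2 : ℝ) (-1 / 2 + 1)} → _)
      (Measure.comap Subtype.val volume)
      (volume.restrict {x | ∀ i, x i ∈ Set.Ioc (-1 / 2 : ℝ) (-1 / 2 + 1)}) :=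
    measurePreserving_subtype_coe (MeasurableSet.univ_pi' fun i => measurableSet_Ioc)
  set Q : Set (ℝ × ℝ) := Set.Ioc (-1 / 2 : ℝ) (-1 / 2 + 1) ×ˢ Set.Ioc (-1 / 2 : ℝ) (-1 / 2 + 1)
  have h3 := (volume_preserving_finTwoArrow ℝ).restrict_preimage
    (s := Q) (measurableSet_Ioc.prod measurableSet_Ioc)
  have hQ : (MeasurableEquiv.finTwoArrow : (Fin 2 → ℝ) ≃ᵐ ℝ × ℝ) ⁻¹' Q =
      {x | ∀ i, x i ∈ Set.Ioc (-1 / 2 : ℝ) (-1 / 2 + 1)} := by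
    ext x
    simp [Q, Fin.forall_fin_two, MeasurableEquiv.finTwoArrow]
  rw [hQ] at h3
  have h4 := h3.comp (h2.comp h1)
  have hs : Measurable fun p : ℝ × ℝ => (2 * a) • p := measurable_const_smul _
  have heq : torusToSquare a = (fun p : ℝ × ℝ => (2 * a) • p) ∘
      (MeasurableEquiv.finTwoArrow ∘ Subtype.val ∘ measurableEquivPiIoc fun _ => -1 / 2) := rfl
  refine ⟨heq ▸ hs.comp h4.measurable, ?_⟩
  rw [heq, ← Measure.map_map hs h4.measurable, h4.map_eq]
  have hpre : Q = (fun p : ℝ × ℝ => (2 * a) • p) ⁻¹' (Set.Ioc (-a) a ×ˢ Set.Ioc (-a) a) := by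
    ext p
    simp only [Q, Set.mem_prod, Set.mem_Ioc, Set.mem_preimage, Prod.smul_fst, Prod.smul_snd,
      smul_eq_mul]
    constructor
    · rintro ⟨⟨_, _⟩, _, _⟩
      refine ⟨⟨?_, ?_⟩, ?_, ?_⟩ <;> nlinarith
    · rintro ⟨⟨_, _⟩, _, _⟩
      refine ⟨⟨?_, ?_⟩, ?_, ?_⟩ <;> nlinarith
  rw [hpre, ← Measure.restrict_map hs (measurableSet_Ioc.prod measurableSet_Ioc),
    Measure.map_addHaar_smul _ (by positivity)]
  congr 3
  rw [abs_of_nonneg (by positivity)]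
  simp
  ring

/-- The closed disk leaves the half-open square only at the two points `(-a, 0)` and `(0, -a)`. -/
theorem planarDisk_inter_square_ae_eq {a : ℝ} (ha : 0 < a) :
    (planarDisk a ∩ Set.Ioc (-a) a ×ˢ Set.Ioc (-a) a : Set (ℝ × ℝ)) =ᵐ[volume] planarDisk a := by
  refine Filter.EventuallyLE.antisymm (Set.inter_subset_left.eventuallyLE) ?_
  have hnull : volume ({(-a, 0), (0, -a)} : Set (ℝ × ℝ)) = 0 :=
    (Set.toFinite _).measure_zero _
  filter_upwards [compl_mem_ae_iff.2 hnull] with p hp hpd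
  refine ⟨hpd, ?_⟩
  have h : p.1 ^ 2 + p.2 ^ 2 ≤ a ^ 2 := hpd
  have h1 := abs_le_of_sq_le_sq' (show p.1 ^ 2 ≤ a ^ 2 by nlinarith [sq_nonneg p.2]) ha.le
  have h2 := abs_le_of_sq_le_sq' (show p.2 ^ 2 ≤ a ^ 2 by nlinarith [sq_nonneg p.1]) ha.le
  have hp1 : p ≠ (-a, 0) := fun h => hp (by simp [h])
  have hp2 : p ≠ (0, -a) := fun h => hp (by simp [h])
  refine ⟨⟨lt_of_le_of_ne h1.1 fun h3 => hp1 ?_, h1.2⟩,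
    lt_of_le_of_ne h2.1 fun h3 => hp2 ?_, h2.2⟩
  · have : p.2 = 0 := by
      rw [← h3] at h
      nlinarith
    exact Prod.ext h3.symm this
  · have : p.1 = 0 := by
      rw [← h3] at h
      nlinarith
    exact Prod.ext this h3.symm

theorem restrict_map_torusToSquare {a : ℝ} (ha : 0 < a) :
    (Measure.map (torusToSquare a) volume).restrict (planarDisk a) =
      ENNReal.ofReal ((4 * a ^ 2)⁻¹) • volume.restrict (planarDisk a) := by
  rw [(map_torusToSquare ha).2, Measure.restrict_smul, Measure.restrict_smul,
    Measure.restrict_restrict (measurableSet_planarDisk a),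
    Measure.restrict_congr_set (planarDisk_inter_square_ae_eq ha)]

theorem memLp_indicator_torusToSquare {a : ℝ} (ha : 0 < a) {f : ℝ × ℝ → ℂ}
    (hf : MemLp f 2 (volume.restrict (planarDisk a))) :
    MemLp (fun t => (planarDisk a).indicator f (torusToSquare a t)) 2 volume := by
  have h : MemLp ((planarDisk a).indicator f) 2 (Measure.map (torusToSquare a) volume) := by
    rw [memLp_indicator_iff_restrict (measurableSet_planarDisk a), restrict_map_torusToSquare ha]
    exact hf.smul_measure ENNReal.ofReal_ne_top
  exact (memLp_map_measure_iff h.1 (map_torusToSquare ha).1.aemeasurable).1 h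

theorem integral_indicator_torusToSquare {a : ℝ} (ha : 0 < a) {f : ℝ × ℝ → ℂ}
    (hf : AEStronglyMeasurable f (volume.restrict (planarDisk a))) :
    ∫ t, (planarDisk a).indicator f (torusToSquare a t) =
      (4 * a ^ 2 : ℂ)⁻¹ * ∫ p in planarDisk a, f p := by
  have hm : AEStronglyMeasurable ((planarDisk a).indicator f)
      (Measure.map (torusToSquare a) volume) := by
    rw [aestronglyMeasurable_indicator_iff (measurableSet_planarDisk a),
      restrict_map_torusToSquare ha]
    exact hf.smul_measure _
  rw [← integral_map (map_torusToSquare ha).1.aemeasurable hm,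
    integral_indicator (measurableSet_planarDisk a), restrict_map_torusToSquare ha,
    integral_smul_measure, ENNReal.toReal_ofReal (by positivity), Complex.real_smul]
  push_cast
  rfl

/-- The character `exp (π i a⁻¹ k · p)` of the square of side `2 a`. -/
noncomputable def squareChar (a : ℝ) (k : ℤ × ℤ) (p : ℝ × ℝ) : ℂ :=
  Complex.exp (Complex.I * ((Real.pi * a⁻¹ * (k.1 * p.1 + k.2 * p.2) : ℝ) : ℂ))

@[fun_prop]
theorem continuous_squareChar (a : ℝ) (k : ℤ × ℤ) : Continuous (squareChar a k) := by
  unfold squareChar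
  fun_prop

theorem norm_squareChar (a : ℝ) (k : ℤ × ℤ) (p : ℝ × ℝ) : ‖squareChar a k p‖ = 1 := by
  rw [squareChar, mul_comm]
  exact Complex.norm_exp_ofReal_mul_I _

theorem mFourier_eq_squareChar {a : ℝ} (ha : 0 < a) (k : ℤ × ℤ) (t : UnitAddTorus (Fin 2)) :
    mFourier ((finTwoArrowEquiv ℤ).symm k) t = squareChar a k (torusToSquare a t) := by
  have ht : ∀ i, t i = (((measurableEquivPiIoc (fun _ => -1 / 2) t).1 i : ℝ) : UnitAddCircle) :=
    fun i => (congrFun ((measurableEquivPiIoc fun _ => -1 / 2).symm_apply_apply t) i).symm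
  have ha' : (a : ℂ) ≠ 0 := by exact_mod_cast ha.ne'
  change ∏ i, fourier ((finTwoArrowEquiv ℤ).symm k i) (t i) = _
  rw [Fin.prod_univ_two, ht 0, ht 1, fourier_coe_apply, fourier_coe_apply, ← Complex.exp_add,
    squareChar, torusToSquare]
  congr 1
  simp only [Prod.smul_mk, smul_eq_mul]
  push_cast
  simp only [finTwoArrowEquiv_symm_apply, Matrix.cons_val_zero, Matrix.cons_val_one]
  field_simp

/-- Parseval's identity on the disk, as a subset of the square of side `2 a`. -/
theorem hasSum_setIntegral_planarDisk_mul {a : ℝ} (ha : 0 < a) {f g : ℝ × ℝ → ℂ}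
    (hf : MemLp f 2 (volume.restrict (planarDisk a)))
    (hg : MemLp g 2 (volume.restrict (planarDisk a))) :
    HasSum (fun k : ℤ × ℤ => (4 * a ^ 2 : ℂ)⁻¹ * (∫ p in planarDisk a, squareChar a k p * f p) *
      ∫ p in planarDisk a, squareChar a (-k) p * g p) (∫ p in planarDisk a, f p * g p) := by
  -- Parseval conjugates its first argument; conjugating `f` beforehand yields the bilinear pairing
  -- `∫ f g`.
  have hf' := (memLp_indicator_torusToSquare ha hf).star
  have hg' := memLp_indicator_torusToSquare ha hg
  have h4 : (4 * a ^ 2 : ℂ) ≠ 0 := by exact_mod_cast (by positivity : (4 * a ^ 2 : ℝ) ≠ 0)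
  have hsum := (finTwoArrowEquiv ℤ).symm.hasSum_iff.2
    (hasSum_prod_mFourierCoeff (hf'.toLp _) (hg'.toLp _))
  have hcf : ∀ k : ℤ × ℤ, (starRingEnd ℂ) (mFourierCoeff (hf'.toLp _)
      ((finTwoArrowEquiv ℤ).symm k)) =
      (4 * a ^ 2 : ℂ)⁻¹ * ∫ p in planarDisk a, squareChar a k p * f p := fun k => by
    rw [← integral_indicator_torusToSquare ha
      (f := fun p => squareChar a k p * f p) ((continuous_squareChar a k).aestronglyMeasurable.mul hf.1), mFourierCoeff, ← integral_conj]
    refine integral_congr_ae ?_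
    filter_upwards [hf'.coeFn_toLp] with t ht
    rw [ht, mFourier_neg, mFourier_eq_squareChar ha, smul_eq_mul, map_mul, Complex.conj_conj,
      Pi.star_apply, Complex.star_def, Complex.conj_conj]
    by_cases h : torusToSquare a t ∈ planarDisk a <;> simp [h]
  have hcg : ∀ k : ℤ × ℤ, mFourierCoeff (hg'.toLp _) ((finTwoArrowEquiv ℤ).symm k) =
      (4 * a ^ 2 : ℂ)⁻¹ * ∫ p in planarDisk a, squareChar a (-k) p * g p := fun k => by
    rw [← integral_indicator_torusToSquare ha
      (f := fun p => squareChar a (-k) p * g p) ((continuous_squareChar a (-k)).aestronglyMeasurable.mul hg.1), mFourierCoeff]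
    refine integral_congr_ae ?_
    filter_upwards [hg'.coeFn_toLp] with t ht
    have hneg : -(finTwoArrowEquiv ℤ).symm k = (finTwoArrowEquiv ℤ).symm (-k) := by
      ext i
      fin_cases i <;> simp
    rw [ht, hneg, mFourier_eq_squareChar ha, smul_eq_mul]
    by_cases h : torusToSquare a t ∈ planarDisk a <;> simp [h]
  have hint : ∫ t, (starRingEnd ℂ) (hf'.toLp _ t) * hg'.toLp _ t =
      (4 * a ^ 2 : ℂ)⁻¹ * ∫ p in planarDisk a, f p * g p := by
    rw [← integral_indicator_torusToSquare ha (f := fun p => f p * g p) (hf.1.mul hg.1)]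
    refine integral_congr_ae ?_
    filter_upwards [hf'.coeFn_toLp, hg'.coeFn_toLp] with t h1 h2
    rw [h1, h2, Pi.star_apply, Complex.star_def, Complex.conj_conj]
    by_cases h : torusToSquare a t ∈ planarDisk a <;> simp [h]
  rw [hint] at hsum
  have h5 := hsum.mul_left (4 * a ^ 2 : ℂ)
  rw [mul_inv_cancel_left₀ h4] at h5
  refine h5.congr_fun fun k => ?_
  simp only [Function.comp_apply]
  rw [hcf, hcg]
  field_simp

end

/-! ### Fourier coefficients of the basis functions and the weights. -/

/-- The conjugate of the basis function `neumannBasis a n m`, in Cartesian coordinates. -/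
noncomputable def planarNeumannConj (a : ℝ) (n : ℕ) (m : ℤ) (p : ℝ × ℝ) : ℂ :=
  ((1 / Real.sqrt (neumannNorm a n m) *
      besselJ m (neumannZero m n / a * ‖(p.1 : ℂ) + p.2 * Complex.I‖) : ℝ) : ℂ) *
    ((1 / Real.sqrt (2 * Real.pi) : ℝ) *
      Complex.exp (-(Complex.I * m * ((p.1 : ℂ) + p.2 * Complex.I).arg)))

theorem measurable_planarNeumannConj (a : ℝ) (n : ℕ) (m : ℤ) :
    Measurable (planarNeumannConj a n m) := by
  have h1 : Measurable fun p : ℝ × ℝ => (p.1 : ℂ) + p.2 * Complex.I :=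
    (by fun_prop : Continuous _).measurable
  have h2 : Measurable fun p : ℝ × ℝ => ((p.1 : ℂ) + p.2 * Complex.I).arg :=
    Complex.measurable_arg.comp h1
  have h3 : Measurable fun p : ℝ × ℝ => besselJ m (neumannZero m n / a *
      ‖(p.1 : ℂ) + p.2 * Complex.I‖) := (by fun_prop : Continuous _).measurable
  unfold planarNeumannConj
  fun_prop

theorem norm_exp_neg_I_mul_int_mul (m : ℤ) (x : ℝ) :
    ‖Complex.exp (-(Complex.I * m * x))‖ = 1 := by
  have := Complex.norm_exp_ofReal_mul_I (-(m * x))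
  rw [← this]
  congr 2
  push_cast
  ring

theorem norm_planarNeumannConj_le (a : ℝ) (n : ℕ) (m : ℤ) (p : ℝ × ℝ) :
    ‖planarNeumannConj a n m p‖ ≤
      1 / Real.sqrt (neumannNorm a n m) * (1 / Real.sqrt (2 * Real.pi)) := by
  rw [planarNeumannConj, norm_mul, norm_mul, norm_exp_neg_I_mul_int_mul, mul_one,
    Complex.norm_real, Complex.norm_real, Real.norm_eq_abs, Real.norm_eq_abs, abs_mul,
    abs_of_nonneg (by positivity : 0 ≤ 1 / Real.sqrt (neumannNorm a n m)),
    abs_of_nonneg (by positivity : 0 ≤ 1 / Real.sqrt (2 * Real.pi))]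
  gcongr
  exact mul_le_of_le_one_right (by positivity) (abs_besselJ_le_one _ _)

theorem memLp_planarNeumannConj (a : ℝ) (n : ℕ) (m : ℤ) :
    MemLp (planarNeumannConj a n m) 2 (volume.restrict (planarDisk a)) :=
  MemLp.of_bound (measurable_planarNeumannConj a n m).aestronglyMeasurable _
    (Filter.Eventually.of_forall (norm_planarNeumannConj_le a n m))

theorem memLp_squareChar (a : ℝ) (k : ℤ × ℤ) :
    MemLp (squareChar a k) 2 (volume.restrict (planarDisk a)) :=
  MemLp.of_bound (continuous_squareChar a k).aestronglyMeasurable 1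
    (Filter.Eventually.of_forall fun p => (norm_squareChar a k p).le)

theorem setIntegral_planarDisk_mul_eq {a : ℝ} (ha : 0 ≤ a) {f g : ℝ × ℝ → ℂ}
    (hf : MemLp f 2 (volume.restrict (planarDisk a)))
    (hg : MemLp g 2 (volume.restrict (planarDisk a))) :
    ∫ p in planarDisk a, f p * g p = ∫ r in (0 : ℝ)..a, ∫ θ in (0 : ℝ)..(2 * Real.pi),
      f (r * Real.cos θ, r * Real.sin θ) * g (r * Real.cos θ, r * Real.sin θ) * r :=
  setIntegral_planarDisk_eq ha (hf.integrable_mul hg)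

/-- The argument enters only through an integer power of `exp(i arg)`, so its branch is irrelevant;
at `r = 0` the angle is lost. -/
theorem planarNeumannConj_polar (a : ℝ) (n : ℕ) (m : ℤ) {r : ℝ} (hr : 0 < r) (θ : ℝ) :
    planarNeumannConj a n m (r * Real.cos θ, r * Real.sin θ) =
      ((1 / Real.sqrt (neumannNorm a n m) * besselJ m (neumannZero m n / a * r) : ℝ) : ℂ) *
        ((1 / Real.sqrt (2 * Real.pi) : ℝ) * Complex.exp (-(Complex.I * m * θ))) := by
  have hw : ((r * Real.cos θ : ℝ) : ℂ) + (r * Real.sin θ : ℝ) * Complex.I =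
      r * Complex.exp (θ * Complex.I) := by
    rw [Complex.exp_mul_I]
    push_cast
    ring
  have hn : ‖(r : ℂ) * Complex.exp (θ * Complex.I)‖ = r := by
    rw [norm_mul, Complex.norm_exp_ofReal_mul_I, mul_one, Complex.norm_real,
      Real.norm_of_nonneg hr.le]
  have harg : Complex.exp (((r : ℂ) * Complex.exp (θ * Complex.I)).arg * Complex.I) =
      Complex.exp (θ * Complex.I) := by
    have h := Complex.norm_mul_exp_arg_mul_I ((r : ℂ) * Complex.exp (θ * Complex.I))
    rw [hn] at h
    exact mul_left_cancel₀ (by exact_mod_cast hr.ne') h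
  have hexp : ∀ x : ℂ, Complex.exp (-(Complex.I * m * x)) =
      Complex.exp (x * Complex.I) ^ (-m) := fun x => by
    rw [← Complex.exp_int_mul]
    congr 1
    push_cast
    ring
  rw [planarNeumannConj]
  simp only
  rw [hw, hn, hexp, hexp, harg]

theorem conj_neumannBasis (a : ℝ) (n : ℕ) (m : ℤ) (r θ : ℝ) :
    (starRingEnd ℂ) (neumannBasis a n m r θ) =
      ((1 / Real.sqrt (neumannNorm a n m) * besselJ m (neumannZero m n / a * r) : ℝ) : ℂ) *
        ((1 / Real.sqrt (2 * Real.pi) : ℝ) * Complex.exp (-(Complex.I * m * θ))) := by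
  rw [neumannBasis, map_mul, map_mul, Complex.conj_ofReal, Complex.conj_ofReal,
    ← Complex.exp_conj, map_mul, map_mul, Complex.conj_I, Complex.conj_ofReal, map_intCast]
  simp only [neg_mul]

theorem neumannCoeff_eq_setIntegral {a : ℝ} (ha : 0 < a) (n : ℕ) (m : ℤ) {ξ : ℝ × ℝ → ℂ}
    (hξ : MemLp ξ 2 (volume.restrict (planarDisk a))) :
    neumannCoeff a n m ξ = ∫ p in planarDisk a, planarNeumannConj a n m p * ξ p := by
  rw [setIntegral_planarDisk_mul_eq ha.le (memLp_planarNeumannConj a n m) hξ,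
    neumannCoeff]
  refine intervalIntegral.integral_congr fun r hr => ?_
  rw [Set.uIcc_of_le ha.le] at hr
  -- The two basis functions may differ at the origin, but the Jacobian `r` kills both integrands.
  rcases hr.1.eq_or_lt with rfl | hr0
  · simp
  · simp only [planarNeumannConj_polar a n m hr0, conj_neumannBasis]
    congr 1
    ext θ
    ring

theorem diskFourier_eq_setIntegral {a : ℝ} (ha : 0 < a) (k : ℤ × ℤ) {ξ : ℝ × ℝ → ℂ}
    (hξ : MemLp ξ 2 (volume.restrict (planarDisk a))) :
    diskFourier a ξ k = ∫ p in planarDisk a, squareChar a (-k) p * ξ p := by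
  rw [setIntegral_planarDisk_mul_eq ha.le (memLp_squareChar a (-k)) hξ, diskFourier]
  congr 1
  ext r
  congr 1
  ext θ
  have h : squareChar a (-k) (r * Real.cos θ, r * Real.sin θ) =
      Complex.exp (-(Complex.I *
        ((Real.pi * a⁻¹ * r * (k.1 * Real.cos θ + k.2 * Real.sin θ) : ℝ) : ℂ))) := by
    rw [squareChar]
    congr 1
    simp only [Prod.fst_neg, Prod.snd_neg]
    push_cast
    ring
  rw [h]
  ring

theorem setIntegral_squareChar_mul_planarNeumannConj {a : ℝ} (ha : 0 < a) (n : ℕ) (m : ℤ)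
    (k : ℤ × ℤ) :
    ∫ p in planarDisk a, squareChar a k p * planarNeumannConj a (n + 1) m p =
      (Real.sqrt (2 * Real.pi) / Real.sqrt (neumannNorm a (n + 1) m) : ℝ) *
        (Complex.I ^ m * Complex.exp (-(Complex.I * m * latticeAngle k))) *
        (a ^ 2 * (besselJ m (neumannZero m (n + 1)) *
          neumannQuotient m (neumannZero m (n + 1)) (Real.pi * latticeNorm k)) : ℝ) := by
  rw [setIntegral_planarDisk_mul_eq ha.le (memLp_squareChar a k)
    (memLp_planarNeumannConj a (n + 1) m)]
  have hinner : ∀ r ∈ Set.uIcc 0 a, (∫ θ in (0 : ℝ)..(2 * Real.pi),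
      squareChar a k (r * Real.cos θ, r * Real.sin θ) *
        planarNeumannConj a (n + 1) m (r * Real.cos θ, r * Real.sin θ) * r) =
      (Real.sqrt (2 * Real.pi) / Real.sqrt (neumannNorm a (n + 1) m) : ℝ) *
        (Complex.I ^ m * Complex.exp (-(Complex.I * m * latticeAngle k))) *
        (besselJ m (neumannZero m (n + 1) / a * r) *
          besselJ m (Real.pi * latticeNorm k / a * r) * r : ℝ) := by
    intro r hr
    rw [Set.uIcc_of_le ha.le] at hr
    rcases hr.1.eq_or_lt with rfl | hr0
    · simp
    have h1 : ∀ θ : ℝ, squareChar a k (r * Real.cos θ, r * Real.sin θ) =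
        Complex.exp (Complex.I *
          (Real.pi * latticeNorm k / a * r * Real.cos (θ - latticeAngle k) : ℝ)) := fun θ => by
      rw [squareChar]
      congr 3
      linear_combination (-Real.pi * a⁻¹ * r) * latticeNorm_mul_cos_sub_latticeAngle k θ
    simp only [h1, planarNeumannConj_polar a (n + 1) m hr0]
    have h2 := integral_exp_mul_exp_cos m (Real.pi * latticeNorm k / a * r) (latticeAngle k)
    set A : ℂ := ((1 / Real.sqrt (neumannNorm a (n + 1) m) *
      besselJ m (neumannZero m (n + 1) / a * r) : ℝ) : ℂ)
    set B : ℂ := ((1 / Real.sqrt (2 * Real.pi) : ℝ) : ℂ)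
    have h3 : ∀ θ : ℝ, Complex.exp (Complex.I *
          (Real.pi * latticeNorm k / a * r * Real.cos (θ - latticeAngle k) : ℝ)) *
        (A * (B * Complex.exp (-(Complex.I * m * θ)))) * r =
        A * B * r * (Complex.exp (-(Complex.I * m * θ)) * Complex.exp (Complex.I *
          (Real.pi * latticeNorm k / a * r * Real.cos (θ - latticeAngle k) : ℝ))) := fun θ => by
      ring
    simp only [h3]
    rw [intervalIntegral.integral_const_mul, h2]
    have h4 : B * (2 * Real.pi) = (Real.sqrt (2 * Real.pi) : ℝ) := by
      have h5 : 1 / Real.sqrt (2 * Real.pi) * (2 * Real.pi) = Real.sqrt (2 * Real.pi) := by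
        rw [one_div_mul_eq_div, Real.div_sqrt]
      rw [← h5]
      simp only [B]
      push_cast
      ring
    rw [show ∀ X : ℂ, A * B * r * (2 * Real.pi * X) = A * (B * (2 * Real.pi)) * r * X from
      fun X => by ring, h4]
    simp only [A]
    push_cast
    ring
  rw [intervalIntegral.integral_congr hinner, intervalIntegral.integral_const_mul,
    intervalIntegral.integral_ofReal, integral_besselJ_div_mul_besselJ_div ha
      (neumannZero_succ_mem m n) (t := Real.pi * latticeNorm k)
      (mul_nonneg Real.pi_pos.le (Real.sqrt_nonneg _))]

/-- Bookkeeping of constants: `i^m J_m(z)` becomes `i^{|m|} (-1)^n |J_m(z)|`, the norm absorbs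
`|J_m(z)|` at the cost of `√2`, and `a²/(4a²)` leaves `1/4`. Here `n` is the index of the zero minus
one. -/
theorem neumannWeight_eq_setIntegral {a : ℝ} (ha : 0 < a) (n : ℕ) (m : ℤ) (k : ℤ × ℤ) :
    neumannWeight a (n + 1) m k = (4 * a ^ 2 : ℂ)⁻¹ *
      ∫ p in planarDisk a, squareChar a k p * planarNeumannConj a (n + 1) m p := by
  have h1 := I_zpow_mul_besselJ_neumannZero m n
  have h2 : (1 / Real.sqrt (neumannNorm a (n + 1) m) : ℂ) *
      (|besselJ m (neumannZero m (n + 1))| : ℝ) =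
      Real.sqrt 2 * neumannAmplitude a (n + 1) m := by
    exact_mod_cast inv_sqrt_neumannNorm_mul_abs_besselJ ha m n
  have h3 : (Real.sqrt 2 : ℂ) * Real.sqrt 2 = 2 := by
    exact_mod_cast Real.mul_self_sqrt zero_le_two
  have ha' : (a : ℂ) ≠ 0 := by exact_mod_cast ha.ne'
  rw [setIntegral_squareChar_mul_planarNeumannConj ha, neumannWeight,
    Real.sqrt_mul zero_le_two]
  have h4 : (4 * a ^ 2 : ℂ)⁻¹ * a ^ 2 = 1 / 4 := by field_simp
  set E := Complex.exp (-(Complex.I * m * latticeAngle k))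
  set Q := neumannQuotient m (neumannZero m (n + 1)) (Real.pi * latticeNorm k)
  push_cast
  rw [show (-1 : ℂ) ^ (n + 1 + 1) = (-1) ^ n by rw [pow_succ, pow_succ]; ring]
  linear_combination
    (-(Real.sqrt 2 * Real.sqrt Real.pi / Real.sqrt (neumannNorm a (n + 1) m) *
        (Complex.I ^ m * E) * besselJ m (neumannZero m (n + 1)) * Q : ℂ)) * h4 -
    (1 / 4 * Real.sqrt 2 * Real.sqrt Real.pi / Real.sqrt (neumannNorm a (n + 1) m) * E * Q : ℂ) *
      h1 -
    (1 / 4 * Real.sqrt 2 * Real.sqrt Real.pi * Complex.I ^ m.natAbs * (-1) ^ n * E * Q : ℂ) * h2 -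
    (1 / 4 * Real.sqrt Real.pi * Complex.I ^ m.natAbs * (-1) ^ n * E * Q *
      neumannAmplitude a (n + 1) m : ℂ) * h3

theorem mainTheorem5 (a : ℝ) (ha : 0 < a) (ξ : ℝ × ℝ → ℂ)
    (hξ : MeasureTheory.MemLp ξ 2 (MeasureTheory.volume.restrict (planarDisk a)))
    (m : ℤ) (n : ℕ) (hn : 1 ≤ n) :
    HasSum (fun k : ℤ × ℤ => neumannWeight a n m k * diskFourier a ξ k)
      (neumannCoeff a n m ξ) := by
  obtain ⟨n, rfl⟩ := Nat.exists_eq_add_of_le' hn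
  rw [neumannCoeff_eq_setIntegral ha _ m hξ]
  refine (hasSum_setIntegral_planarDisk_mul ha (memLp_planarNeumannConj a (n + 1) m) hξ).congr_fun
    fun k => ?_
  rw [neumannWeight_eq_setIntegral ha, diskFourier_eq_setIntegral ha k hξ]
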